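/- For integers $t\ge 1$ and $n_1,\dots,n_t\ge 1$, let $P_k$ denote the path on $k$ vertices and let $R(P_{n_1},\dots,P_{n_t})$ be the smallest positive integer $N$ such that for every colouring of the edges of the complete graph $K_N$ with colours $1,\dots,t$ there is some $i$ for which the edges of colour $i$ contain a copy of $P_{n_i}$ as a (not necessarily induced) subgraph. **Theorem.** Let $m\ge n\ge 2$ be integers with $(n,m)\notin\{(2,2),(3,3),(3,4)\}$. Then $$R(P_3,P_n,P_m)=R(P_n,P_m)=m+\left\lfloor \tfrac n2\right\rfloor-1 .$$ Moreover, $R(P_3,P_3,P_3)=R(P_3,P_3,P_4)=5$. -/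

import Mathlib

namespace RamseyPaths

open SimpleGraph

/-- `Arrows G N`: for every assignment of the colours `i : ι` to the edges of the complete graph
on `N` vertices, some colour class `i` contains a (not necessarily induced) subgraph isomorphic
to `G i`. The colour classes partition the edges; some of them may be empty. -/
def Arrows {ι : Type*} {V : ι → Type*} (G : (i : ι) → SimpleGraph (V i)) (N : ℕ) : Prop :=
  ∀ c : TopEdgeLabeling (Fin N) ι, ∃ i : ι, (G i).IsContained (c.labelGraph i)

/-- `IsRamseyNumber G R`: the multicolour Ramsey number of the family `G` exists and equals `R`,
that is, `R` is the smallest positive integer `N` such that every colouring of the edges of the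
complete graph on `N` vertices has, for some `i`, a copy of `G i` in colour `i`. -/
def IsRamseyNumber {ι : Type*} {V : ι → Type*} (G : (i : ι) → SimpleGraph (V i)) (R : ℕ) : Prop :=
  IsLeast {N : ℕ | 0 < N ∧ Arrows G N} R

/-- The family of paths `P_{p 0}, …, P_{p (t - 1)}`, where `P_k` is the path on `k` vertices. -/
def paths {t : ℕ} (p : Fin t → ℕ) (i : Fin t) : SimpleGraph (Fin (p i)) :=
  pathGraph (p i)

end RamseyPaths

/-!
If one colour contains no `P₃`, its edges form a matching. So the upper bound is a statement on a graph
that is complete up to a matching (the *missing* pairs) and whose edges are red or blue: on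
`m + n / 2 - 1` vertices it has a red path on `n` or a blue path on `m` vertices
(`hasPath_or_hasPath`). The cases `n ≤ 3` are immediate; let `n ≥ 4`. By
induction there is a blue path `x 0, …, x (M - 1)` on `M = m - 1` vertices, and there is a set `Y` of
`k = n / 2` vertices outside it. If this blue path is a longest one, a vertex of `Y` is blue to
neither of its ends nor to two consecutive vertices of it. So a vertex of `Y` is red to an end of
every edge of the path, unless it misses an end of this edge (`Config.red_or_red`).

The red path is built from red paths that alternate between `Y` and the blue path and have both ends
in `Y`. Choose a longest such path `W`, and a longest one `W'` among those disjoint from `W`. The ends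
of `W` and `W'` and the remaining vertices of `Y` have pairwise no common red neighbour among the
unused vertices, so on each edge of the blue path without used ends (a *free* edge) one of any three
of them misses an end. A vertex spoils at most two free edges, and two vertices have at most one
spoilt edge in common. Counting free edges (`le_card_freeEdges`) then shows that `W` and `W'` cover `Y`
(`LongestPair.cover`).

If `W` alone covers `Y`, it has `2 * k - 1` vertices and can be prolonged at its ends, or closes to a
red cycle that can be opened elsewhere (`IsAlternating.exists_red_path_odd`). If both paths are
needed, ends of them are joined by a red edge, as blue edges between them allow too few free edges;
this gives a red path with `2 * k` vertices (`LongestPair.exists_red_path_even`). For odd `n` another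
vertex is needed. One of the two paths does not close to a cycle, since otherwise the cycle could be
linked to the other path to give a longer alternating path. Then five free edges are spoilt by three
vertices, and one of them, `q`, misses the common vertex `w` of two free edges to which the other two
have no missing pair. Either `w` has an unused red neighbour and a red path is prolonged through `w`,
or `q` takes the place of `w` in the blue path and `w` is inserted at another free edge
(`Config.exists_red_path_of_exclusive`).

For the lower bound, `n / 2 - 1` vertices have all their edges red and the others are blue; the value
`5` comes from the decomposition of the complete graph on four vertices into perfect matchings.
-/

namespace RamseyPaths

open SimpleGraph

/-! ### Paths as lists of vertices -/

section PathLists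

variable {V : Type*}

/-- `IsPathList G a b L`: the list `L` enumerates the vertices of a path of `G` from `a` to `b`. -/
def IsPathList (G : SimpleGraph V) (a b : V) (L : List V) : Prop :=
  L.IsChain G.Adj ∧ L.Nodup ∧ L.head? = some a ∧ L.getLast? = some b

namespace IsPathList

variable {G H : SimpleGraph V} {a b c d v : V} {L K : List V}

lemma singleton (G : SimpleGraph V) (a : V) : IsPathList G a a [a] := by
  simp [IsPathList]

lemma nodup (h : IsPathList G a b L) : L.Nodup := h.2.1

lemma mono (hle : G ≤ H) (h : IsPathList G a b L) : IsPathList H a b L :=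
  ⟨h.1.imp fun _ _ hab => hle hab, h.2⟩

lemma reverse (h : IsPathList G a b L) : IsPathList G b a L.reverse := by
  obtain ⟨h1, h2, h3, h4⟩ := h
  refine ⟨?_, by simpa using h2, by simpa using h4, by simpa using h3⟩
  rw [List.isChain_reverse]
  exact h1.imp fun _ _ hab => hab.symm

lemma append (h : IsPathList G a b L) (h' : IsPathList G c d K) (hbc : G.Adj b c)
    (hd : L.Disjoint K) : IsPathList G a d (L ++ K) := by
  obtain ⟨h1, h2, h3, h4⟩ := h
  obtain ⟨k1, k2, k3, k4⟩ := h'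
  refine ⟨?_, ?_, by simp [h3], by simp [k4]⟩
  · rw [List.isChain_append]
    refine ⟨h1, k1, ?_⟩
    intro x hx y hy
    simp_all
  · exact List.nodup_append'.2 ⟨h2, k2, hd⟩

lemma cons (h : IsPathList G a b L) (hv : G.Adj v a) (hvL : v ∉ L) :
    IsPathList G v b (v :: L) :=
  (singleton G v).append h hv (by simpa using hvL)

lemma concat (h : IsPathList G a b L) (hv : G.Adj b v) (hvL : v ∉ L) :
    IsPathList G a v (L ++ [v]) :=
  h.append (singleton G v) hv (by simpa using hvL)

lemma left_mem (h : IsPathList G a b L) : a ∈ L := List.mem_of_head? h.2.2.1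

lemma right_mem (h : IsPathList G a b L) : b ∈ L := List.mem_of_getLast? h.2.2.2

lemma length_pos (h : IsPathList G a b L) : 0 < L.length := List.length_pos_of_mem h.left_mem

/-- A path with equal end vertices is trivial. -/
lemma eq_singleton (h : IsPathList G a a L) : L = [a] := by
  obtain ⟨-, h2, h3, h4⟩ := h
  match L, h2, h3, h4 with
  | [x], _, h3, _ => simpa using h3
  | x :: y :: l, h2, h3, h4 =>
    exfalso
    simp only [List.head?_cons, Option.some.injEq] at h3
    rw [List.getLast?_cons_cons] at h4
    have := List.mem_of_getLast? h4
    rw [List.nodup_cons] at h2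
    exact h2.1 (h3 ▸ this)

lemma left_ne_right (h : IsPathList G a b L) (hL : 1 < L.length) : a ≠ b := by
  rintro rfl
  simp [h.eq_singleton] at hL

/-- Any vertex of a cycle is the start of a path through all vertices of the cycle; the last vertex
of that path is a neighbour of the first one. -/
lemma rotate (h : IsPathList G a b L) (hab : G.Adj b a) (hv : v ∈ L) :
    ∃ u K, IsPathList G v u K ∧ K.Perm L ∧ G.Adj u v := by
  obtain ⟨h1, h2, h3, h4⟩ := h
  obtain ⟨P, Q, rfl⟩ := List.append_of_mem hv
  rcases List.eq_nil_or_concat' P with rfl | ⟨P', u, rfl⟩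
  · simp only [List.nil_append, List.head?_cons, Option.some.injEq] at h3
    subst h3
    exact ⟨b, _, ⟨h1, h2, rfl, h4⟩, .refl _, hab⟩
  · refine ⟨u, (v :: Q) ++ (P' ++ [u]), ⟨?_, ?_, rfl, ?_⟩,
      List.perm_append_comm, ?_⟩
    · rw [List.isChain_append] at h1 ⊢
      refine ⟨h1.2.1, h1.1, ?_⟩
      intro x hx y hy
      have hx' : x = b := by
        rw [List.getLast?_append, hx] at h4
        simpa using h4
      have hy' : y = a := by
        rw [List.head?_append, hy] at h3
        simpa using h3
      subst hx' hy'
      exact hab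
    · exact (List.perm_append_comm.nodup_iff).1 h2
    · rw [← List.append_assoc, List.getLast?_concat]
    · rw [List.isChain_append] at h1
      exact h1.2.2 u (by simp) v (by simp)

/-- Inserting a disjoint path between two consecutive vertices of a path. -/
lemma exists_insert (h : IsPathList G a b L) {i : ℕ} (hi : i + 1 < L.length)
    (hK : IsPathList G c d K) (hd : L.Disjoint K) (h1 : G.Adj L[i] c) (h2 : G.Adj d L[i + 1]) :
    ∃ N, IsPathList G a b N ∧ N.length = L.length + K.length := by
  obtain ⟨c1, c2, c3, c4⟩ := h
  have l1 : (L.take (i + 1)).getLast? = some L[i] := by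
    simp [List.getLast?_take, List.getElem?_eq_getElem (show i < L.length by omega)]
  have l2 : (L.drop (i + 1)).head? = some L[i + 1] := by
    rw [List.head?_drop, List.getElem?_eq_getElem]
  have l3 : (L.take (i + 1)).head? = some a := by
    rw [List.head?_take]; simpa using c3
  have l4 : (L.drop (i + 1)).getLast? = some b := by
    simp [List.getLast?_drop, c4, hi]
  have p1 : IsPathList G a L[i] (L.take (i + 1)) :=
    ⟨c1.take _, c2.sublist (List.take_sublist _ _), l3, l1⟩
  have p2 : IsPathList G L[i + 1] b (L.drop (i + 1)) :=
    ⟨c1.drop _, c2.sublist (List.drop_sublist _ _), l2, l4⟩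
  have p3 := p1.append (hK.append p2 h2 fun v hv hm => hd (List.mem_of_mem_drop hm) hv) h1 (by
    rw [List.disjoint_append_right]
    exact ⟨fun v hm hv => hd (List.mem_of_mem_take hm) hv,
      List.disjoint_take_drop c2 (le_refl (i + 1))⟩)
  refine ⟨_, p3, ?_⟩
  simp
  omega

end IsPathList

/-- Among the lists without repetitions that satisfy a predicate there is a longest one. -/
lemma exists_longest_list [Fintype V] (P : List V → Prop) (hP : ∀ L, P L → L.Nodup)
    (hex : ∃ L, P L) : ∃ L, P L ∧ ∀ K, P K → K.length ≤ L.length := by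
  obtain ⟨L₀, h₀⟩ := hex
  have hb : ∀ L, P L → L.length ≤ Fintype.card V := fun L hL => (hP L hL).length_le_card
  let p : ℕ → Prop := fun n => ∃ L, P L ∧ L.length = n
  classical
  obtain ⟨L, hL, hlen⟩ : p (Nat.findGreatest p (Fintype.card V)) :=
    Nat.findGreatest_spec (P := p) (hb L₀ h₀) ⟨L₀, h₀, rfl⟩
  refine ⟨L, hL, fun K hK => ?_⟩
  rw [hlen]
  exact Nat.le_findGreatest (hb K hK) ⟨K, hK, rfl⟩

end PathLists

/-! ### Longest blue paths and the edges that a vertex misses -/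

section Configuration

open scoped Classical

variable {V : Type*} {R B : SimpleGraph V} {M : ℕ} {x : ℕ → V} {Y : Finset V}

/-- The pair `a`, `b` is an edge of the complete graph that lies in neither of the graphs `R` (the
red edges) and `B` (the blue edges). -/
def Missing (R B : SimpleGraph V) (a b : V) : Prop := a ≠ b ∧ ¬ R.Adj a b ∧ ¬ B.Adj a b

lemma Missing.symm {a b : V} (h : Missing R B a b) : Missing R B b a :=
  ⟨h.1.symm, fun h' => h.2.1 h'.symm, fun h' => h.2.2 h'.symm⟩

lemma adj_or_missing {a b : V} (h : a ≠ b) : R.Adj a b ∨ B.Adj a b ∨ Missing R B a b := by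
  unfold Missing; tauto

/-- The vertices `x 0, …, x (M - 1)` form, in this order, a path of `B`, and no path of `B` has more
than `M` vertices. -/
structure IsLongestPath (B : SimpleGraph V) (M : ℕ) (x : ℕ → V) : Prop where
  pos : 0 < M
  inj : ∀ i j, i < M → j < M → x i = x j → i = j
  chain : ∀ i, i + 1 < M → B.Adj (x i) (x (i + 1))
  le : ∀ a b L, IsPathList B a b L → L.length ≤ M

namespace IsLongestPath

lemma isPathList (h : IsLongestPath B M x) :
    IsPathList B (x 0) (x (M - 1)) ((List.range M).map x) := by
  have hM := h.pos
  refine ⟨?_, ?_, ?_, ?_⟩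
  · rw [List.isChain_iff_getElem]
    intro i hi
    simp only [List.length_map, List.length_range] at hi
    simpa using h.chain i hi
  · refine List.Nodup.map_on ?_ List.nodup_range
    intro i hi j hj hij
    exact h.inj i j (by simpa using hi) (by simpa using hj) hij
  · rw [List.head?_map, List.head?_range, if_neg (by omega)]
    rfl
  · rw [List.getLast?_map, List.getLast?_range, if_neg (by omega)]
    rfl

lemma not_mem {v : V} (hv : ∀ i < M, x i ≠ v) : v ∉ (List.range M).map x := by
  simpa using hv

lemma not_adj_first (h : IsLongestPath B M x) {v : V} (hv : ∀ i < M, x i ≠ v) :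
    ¬ B.Adj v (x 0) := by
  intro hb
  have := h.le _ _ _ (h.isPathList.cons hb (not_mem hv))
  simp at this

lemma not_adj_consecutive (h : IsLongestPath B M x) {v : V} (hv : ∀ i < M, x i ≠ v) {i : ℕ}
    (hi : i + 1 < M) (h1 : B.Adj v (x i)) : ¬ B.Adj v (x (i + 1)) := by
  intro h2
  obtain ⟨K, hK, hlen⟩ := h.isPathList.exists_insert (i := i) (by simpa using hi)
    (IsPathList.singleton B v) (by simpa using hv) (by simpa using h1.symm) (by simpa using h2)
  have := h.le _ _ _ hK
  simp at hlen
  omega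

/-- Two adjacent vertices outside a longest path are not adjacent to two consecutive vertices. -/
lemma not_adj_of_adj (h : IsLongestPath B M x) {v w : V} (hv : ∀ i < M, x i ≠ v)
    (hw : ∀ i < M, x i ≠ w) (hvw : B.Adj v w) {i : ℕ} (hi : i + 1 < M) (h1 : B.Adj v (x i)) :
    ¬ B.Adj w (x (i + 1)) := by
  intro h2
  obtain ⟨K, hK, hlen⟩ := h.isPathList.exists_insert (i := i) (by simpa using hi)
    ((IsPathList.singleton B w).cons hvw (by simpa using hvw.ne))
    (by simpa using ⟨hv, hw⟩) (by simpa using h1.symm) (by simpa using h2)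
  have := h.le _ _ _ hK
  simp at hlen
  omega

lemma reverse (h : IsLongestPath B M x) : IsLongestPath B M (fun i => x (M - 1 - i)) where
  pos := h.pos
  inj i j hi hj hij := by
    have := h.inj _ _ (by omega) (by omega) hij
    omega
  chain i hi := by
    have := h.chain (M - 1 - (i + 1)) (by omega)
    rw [show M - 1 - (i + 1) + 1 = M - 1 - i by omega] at this
    exact this.symm
  le := h.le

/-- Replacing an inner vertex of a longest path by another common neighbour of the two vertices next
to it gives a longest path. -/
lemma replace (h : IsLongestPath B M x) {v : V} (hv : ∀ i < M, x i ≠ v) {i : ℕ}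
    (hi : i + 2 < M) (h1 : B.Adj v (x i)) (h2 : B.Adj v (x (i + 2))) :
    IsLongestPath B M (fun j => if j = i + 1 then v else x j) where
  pos := h.pos
  inj j l hj hl hjl := by
    split_ifs at hjl with h3 h4 h4
    · omega
    · exact absurd hjl.symm (hv _ hl)
    · exact absurd hjl (hv _ hj)
    · exact h.inj _ _ hj hl hjl
  chain j hj := by
    split_ifs with h3 h4 h4
    · omega
    · subst h3; exact h2
    · obtain rfl : j = i := by omega
      exact h1.symm
    · exact h.chain _ hj
  le := h.le

end IsLongestPath

/-- The positions `i` such that neither `x i` nor `x (i + 1)` belongs to the list `L`. -/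
noncomputable def freeEdges (M : ℕ) (x : ℕ → V) (L : List V) : Finset ℕ :=
  (Finset.range (M - 1)).filter fun i => x i ∉ L ∧ x (i + 1) ∉ L

/-- The positions `i` such that `x i` belongs to the list `L`. -/
noncomputable def usedIdx (M : ℕ) (x : ℕ → V) (L : List V) : Finset ℕ :=
  (Finset.range M).filter fun i => x i ∈ L

lemma mem_freeEdges {L : List V} {i : ℕ} :
    i ∈ freeEdges M x L ↔ i + 1 < M ∧ x i ∉ L ∧ x (i + 1) ∉ L := by
  simp only [freeEdges, Finset.mem_filter, Finset.mem_range]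
  constructor <;> rintro ⟨h1, h2⟩ <;> exact ⟨by omega, h2⟩

/-- Every position in a list blocks at most two edges of the path, and the two end positions block
at most one edge each. -/
lemma le_card_freeEdges {L : List V} (hM : 2 ≤ M) (h0 : x 0 ∈ L) (h1 : x (M - 1) ∈ L) :
    M + 1 ≤ (freeEdges M x L).card + 2 * (usedIdx M x L).card := by
  have hsub : Finset.range (M - 1) ⊆ freeEdges M x L ∪ ((usedIdx M x L).erase (M - 1) ∪
      ((usedIdx M x L).erase 0).image fun i => i - 1) := by
    intro i hi
    have hi' : i < M - 1 := by simpa using hi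
    simp only [Finset.mem_union, mem_freeEdges, Finset.mem_erase, usedIdx, Finset.mem_filter,
      Finset.mem_range, Finset.mem_image]
    by_cases h3 : x i ∈ L
    · exact Or.inr (Or.inl ⟨by omega, by omega, h3⟩)
    by_cases h4 : x (i + 1) ∈ L
    · exact Or.inr (Or.inr ⟨i + 1, ⟨by omega, by omega, h4⟩, by omega⟩)
    · exact Or.inl ⟨by omega, h3, h4⟩
  have hcard := (Finset.card_le_card hsub).trans (Finset.card_union_le _ _)
  have hcard2 := Finset.card_union_le ((usedIdx M x L).erase (M - 1))
    (((usedIdx M x L).erase 0).image fun i => i - 1)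
  have hcard3 : (((usedIdx M x L).erase 0).image fun i => i - 1).card ≤ _ :=
    Finset.card_image_le
  have e1 : ((usedIdx M x L).erase (M - 1)).card + 1 = (usedIdx M x L).card :=
    Finset.card_erase_add_one (by simp [usedIdx, h1]; omega)
  have e2 : ((usedIdx M x L).erase 0).card + 1 = (usedIdx M x L).card :=
    Finset.card_erase_add_one (by simp [usedIdx, h0]; omega)
  rw [Finset.card_range] at hcard
  omega

lemma card_filter_touch_le (inj : ∀ i j, i < M → j < M → x i = x j → i = j) (L : List V) (v : V) :
    ((freeEdges M x L).filter fun i => x i = v ∨ x (i + 1) = v).card ≤ 2 := by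
  rw [Finset.filter_or]
  refine (Finset.card_union_le _ _).trans ?_
  have h1 : ((freeEdges M x L).filter fun i => x i = v).card ≤ 1 := by
    rw [Finset.card_le_one]
    intro i hi j hj
    rw [Finset.mem_filter, mem_freeEdges] at hi hj
    exact inj i j (by omega) (by omega) (hi.2.trans hj.2.symm)
  have h2 : ((freeEdges M x L).filter fun i => x (i + 1) = v).card ≤ 1 := by
    rw [Finset.card_le_one]
    intro i hi j hj
    rw [Finset.mem_filter, mem_freeEdges] at hi hj
    have := inj (i + 1) (j + 1) (by omega) (by omega) (hi.2.trans hj.2.symm)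
    omega
  omega

/-- A graph that is complete up to a matching and whose edges are red (`R`) or blue (`B`), together
with a longest blue path `x 0, …, x (M - 1)` and a set `Y` of vertices outside this path. -/
structure Config (R B : SimpleGraph V) (M : ℕ) (x : ℕ → V) (Y : Finset V) : Prop
    extends IsLongestPath B M x where
  miss : ∀ a b c, Missing R B a b → Missing R B a c → b = c
  disj : ∀ i < M, x i ∉ Y

/-- The vertices `a` and `b` have no common red neighbour on the path `x` outside the list `L`. -/
def NoCommon (R : SimpleGraph V) (M : ℕ) (x : ℕ → V) (L : List V) (a b : V) : Prop :=
  ∀ i < M, x i ∉ L → R.Adj a (x i) → ¬ R.Adj b (x i)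

lemma NoCommon.symm {L : List V} {a b : V} (h : NoCommon R M x L a b) : NoCommon R M x L b a :=
  fun i hi hL hb ha => h i hi hL ha hb

/-- The positions of the free edges of the path one of whose ends is missing at `y`. -/
noncomputable def missEdges (R B : SimpleGraph V) (M : ℕ) (x : ℕ → V) (L : List V) (y : V) :
    Finset ℕ :=
  (freeEdges M x L).filter fun i => Missing R B y (x i) ∨ Missing R B y (x (i + 1))

lemma mem_missEdges {L : List V} {y : V} {i : ℕ} : i ∈ missEdges R B M x L y ↔
    i ∈ freeEdges M x L ∧ (Missing R B y (x i) ∨ Missing R B y (x (i + 1))) := by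
  simp [missEdges]

namespace Config

variable {L : List V} {a b c y : V} {i : ℕ}

lemma ne_of_mem (h : Config R B M x Y) (hy : y ∈ Y) : ∀ i < M, x i ≠ y :=
  fun i hi hxy => h.disj i hi (hxy ▸ hy)

lemma reverse (h : Config R B M x Y) : Config R B M (fun i => x (M - 1 - i)) Y :=
  ⟨h.toIsLongestPath.reverse, h.miss, fun i hi => h.disj _ (by omega)⟩

lemma miss_left (h : Config R B M x Y) (ha : Missing R B a c) (hb : Missing R B b c) : a = b :=
  h.miss c a b ha.symm hb.symm

lemma card_missEdges_le (h : Config R B M x Y) (L : List V) (y : V) :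
    (missEdges R B M x L y).card ≤ 2 := by
  by_cases hv : ∃ v, Missing R B y v
  · obtain ⟨v, hv⟩ := hv
    refine le_trans (Finset.card_le_card ?_) (card_filter_touch_le h.inj L v)
    intro i hi
    rw [mem_missEdges] at hi
    rw [Finset.mem_filter]
    exact ⟨hi.1, hi.2.imp (fun hm => h.miss _ _ _ hm hv) fun hm => h.miss _ _ _ hm hv⟩
  · have : missEdges R B M x L y = ∅ := by
      rw [Finset.eq_empty_iff_forall_notMem]
      intro i hi
      rw [mem_missEdges] at hi
      exact hv (hi.2.elim (fun hm => ⟨_, hm⟩) fun hm => ⟨_, hm⟩)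
    simp [this]

/-- Two vertices miss different vertices, so only one edge can join the two vertices they miss. -/
lemma card_missEdges_inter_le (h : Config R B M x Y) (L : List V) (hab : a ≠ b) :
    (missEdges R B M x L a ∩ missEdges R B M x L b).card ≤ 1 := by
  rw [Finset.card_le_one]
  intro i hi j hj
  rw [Finset.mem_inter, mem_missEdges, mem_missEdges, mem_freeEdges] at hi hj
  obtain ⟨⟨⟨hi, -⟩, ia⟩, -, ib⟩ := hi
  obtain ⟨⟨⟨hj, -⟩, ja⟩, -, jb⟩ := hj
  have key : ∀ {p q r s}, p < M → q < M → Missing R B a (x p) → Missing R B b (x q) →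
      Missing R B a (x r) → Missing R B b (x s) → r < M → s < M → p = r ∧ q = s ∧ p ≠ q := by
    intro p q r s hp hq h1 h2 h3 h4 hr hs
    refine ⟨h.inj _ _ hp hr (h.miss _ _ _ h1 h3), h.inj _ _ hq hs (h.miss _ _ _ h2 h4), ?_⟩
    rintro rfl
    exact hab (h.miss_left h1 h2)
  rcases ia with ia | ia <;> rcases ib with ib | ib <;> rcases ja with ja | ja <;>
    rcases jb with jb | jb <;>
    · have := key (by omega) (by omega) ia ib ja jb (by omega) (by omega)
      omega

/-- A vertex of `Y` is red to one of the ends of any edge of the path that it does not miss. -/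
lemma red_or_red (h : Config R B M x Y) (hy : y ∈ Y) (hi : i + 1 < M)
    (h1 : ¬ Missing R B y (x i)) (h2 : ¬ Missing R B y (x (i + 1))) :
    R.Adj y (x i) ∨ R.Adj y (x (i + 1)) := by
  have hne := h.ne_of_mem hy
  have n1 := adj_or_missing (R := R) (B := B) (hne i (by omega)).symm
  have n2 := adj_or_missing (R := R) (B := B) (hne (i + 1) hi).symm
  have := h.not_adj_consecutive hne hi
  tauto

lemma red_or_red' (h : Config R B M x Y) (hy : y ∈ Y) (hi : i ∈ freeEdges M x L)
    (h1 : i ∉ missEdges R B M x L y) : R.Adj y (x i) ∨ R.Adj y (x (i + 1)) := by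
  rw [mem_missEdges] at h1
  exact h.red_or_red hy (mem_freeEdges.1 hi).1 (by tauto) (by tauto)

lemma red_first (h : Config R B M x Y) (hy : y ∈ Y) (h1 : ¬ Missing R B y (x 0)) :
    R.Adj y (x 0) := by
  have hne := h.ne_of_mem hy
  have n1 := adj_or_missing (R := R) (B := B) (hne 0 h.pos).symm
  have := h.not_adj_first hne
  tauto

lemma red_last (h : Config R B M x Y) (hy : y ∈ Y) (h1 : ¬ Missing R B y (x (M - 1))) :
    R.Adj y (x (M - 1)) := by
  have := h.reverse.red_first hy (by simpa using h1)
  simpa using this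

/-- If more than two edges are free, a vertex of `Y` has a red neighbour on a free edge. -/
lemma exists_red (h : Config R B M x Y) (hy : y ∈ Y) (hc : 2 < (freeEdges M x L).card) :
    ∃ i < M, x i ∉ L ∧ R.Adj y (x i) := by
  obtain ⟨i, hi, hi'⟩ := Finset.exists_mem_notMem_of_card_lt_card
    ((h.card_missEdges_le L y).trans_lt hc)
  have hf := mem_freeEdges.1 hi
  rcases h.red_or_red' hy hi hi' with hr | hr
  · exact ⟨i, by omega, hf.2.1, hr⟩
  · exact ⟨i + 1, by omega, hf.2.2, hr⟩

/-- If more than four edges are free, a vertex of `Y` has two red neighbours on free edges. -/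
lemma exists_red_ne (h : Config R B M x Y) (hy : y ∈ Y) (hc : 4 < (freeEdges M x L).card) (v : V) :
    ∃ i < M, x i ∉ L ∧ R.Adj y (x i) ∧ x i ≠ v := by
  obtain ⟨i, hi, hi'⟩ := Finset.exists_mem_notMem_of_card_lt_card
    (((Finset.card_union_le (missEdges R B M x L y)
      ((freeEdges M x L).filter fun i => x i = v ∨ x (i + 1) = v)).trans
      (add_le_add (h.card_missEdges_le L y) (card_filter_touch_le h.inj L v))).trans_lt hc)
  have hf := mem_freeEdges.1 hi
  rw [Finset.mem_union, not_or, Finset.mem_filter] at hi'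
  rcases h.red_or_red' hy hi hi'.1 with hr | hr
  · exact ⟨i, by omega, hf.2.1, hr, fun hv => hi'.2 ⟨hi, Or.inl hv⟩⟩
  · exact ⟨i + 1, by omega, hf.2.2, hr, fun hv => hi'.2 ⟨hi, Or.inr hv⟩⟩

/-- Each of three vertices is red to an end of a free edge that it does not miss, so two of the
three are red to the same end. -/
lemma freeEdges_subset_of_three (h : Config R B M x Y) (ha : a ∈ Y) (hb : b ∈ Y) (hc : c ∈ Y)
    (hab : NoCommon R M x L a b) (hac : NoCommon R M x L a c) (hbc : NoCommon R M x L b c) :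
    freeEdges M x L ⊆
      missEdges R B M x L a ∪ (missEdges R B M x L b ∪ missEdges R B M x L c) := by
  intro i hi
  have hf := mem_freeEdges.1 hi
  by_contra hcon
  simp only [Finset.mem_union, not_or] at hcon
  have r1 := h.red_or_red' ha hi hcon.1
  have r2 := h.red_or_red' hb hi hcon.2.1
  have r3 := h.red_or_red' hc hi hcon.2.2
  have m1 := hab i (by omega) hf.2.1
  have m2 := hab (i + 1) (by omega) hf.2.2
  have m3 := hac i (by omega) hf.2.1
  have m4 := hac (i + 1) (by omega) hf.2.2
  have m5 := hbc i (by omega) hf.2.1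
  have m6 := hbc (i + 1) (by omega) hf.2.2
  tauto

/-- If `a` and `b` are joined by a blue edge and miss neither end of a free edge, they are red to
different ends of it and blue to the other ones, which gives a longer blue path. -/
lemma freeEdges_subset_of_blue (h : Config R B M x Y) (ha : a ∈ Y) (hb : b ∈ Y)
    (hab : NoCommon R M x L a b) (hblue : B.Adj a b) :
    freeEdges M x L ⊆ missEdges R B M x L a ∪ missEdges R B M x L b := by
  intro i hi
  have hf := mem_freeEdges.1 hi
  by_contra hcon
  simp only [Finset.mem_union, not_or] at hcon
  have key : ∀ {p q}, p ∈ Y → q ∈ Y → NoCommon R M x L p q → B.Adj p q →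
      i ∉ missEdges R B M x L p → i ∉ missEdges R B M x L q → R.Adj p (x i) → False := by
    intro p q hp hq hpq hpqb np nq r1
    have r2 := (h.red_or_red' hq hi nq).resolve_left (hpq i (by omega) hf.2.1 r1)
    have b1 := (adj_or_missing (R := R) (B := B) (h.ne_of_mem hp (i + 1) (by omega)).symm).resolve_left
      (hpq.symm (i + 1) (by omega) hf.2.2 r2)
    have b2 := (adj_or_missing (R := R) (B := B) (h.ne_of_mem hq i (by omega)).symm).resolve_left
      (hpq i (by omega) hf.2.1 r1)
    rw [mem_missEdges] at np nq
    exact h.not_adj_of_adj (h.ne_of_mem hq) (h.ne_of_mem hp) hpqb.symm hf.1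
      (b2.resolve_right (by tauto)) (b1.resolve_right (by tauto))
  rcases h.red_or_red' ha hi hcon.1 with r1 | r1
  · exact key ha hb hab hblue hcon.1 hcon.2 r1
  · exact key hb ha hab.symm hblue.symm hcon.2 hcon.1
      ((h.red_or_red' hb hi hcon.2).resolve_right (hab (i + 1) (by omega) hf.2.2 r1))

end Config

end Configuration

/-! ### Alternating red paths -/

section Alternating

open scoped Classical

variable {V : Type*} {R B : SimpleGraph V} {M : ℕ} {x : ℕ → V} {Y : Finset V}

lemma IsPathList.cons_inv {G : SimpleGraph V} {a b v w : V} {L : List V}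
    (h : IsPathList G a b (v :: w :: L)) :
    a = v ∧ G.Adj v w ∧ v ∉ w :: L ∧ IsPathList G w b (w :: L) := by
  obtain ⟨h1, h2, h3, h4⟩ := h
  rw [List.isChain_cons_cons] at h1
  rw [List.nodup_cons] at h2
  rw [List.getLast?_cons_cons] at h4
  exact ⟨by simpa using h3.symm, h1.1, h2.1, h1.2, h2.2, rfl, h4⟩

/-- The red edges between the path `x 0, …, x (M - 1)` and the set `Y`. -/
def altGraph (R : SimpleGraph V) (M : ℕ) (x : ℕ → V) (Y : Finset V) : SimpleGraph V where
  Adj a b := R.Adj a b ∧ ((a ∈ Y ∧ ∃ i < M, x i = b) ∨ (b ∈ Y ∧ ∃ i < M, x i = a))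
  symm := ⟨fun _ _ h => ⟨h.1.symm, h.2.symm⟩⟩
  loopless := ⟨fun _ h => R.loopless.irrefl _ h.1⟩

lemma altGraph_le : altGraph R M x Y ≤ R := fun _ _ h => h.1

/-- `IsAlternating R M x Y a b L`: the list `L` enumerates the vertices of a red path from `a ∈ Y` to
`b ∈ Y` whose vertices lie alternately in `Y` and on the path `x 0, …, x (M - 1)`. -/
def IsAlternating (R : SimpleGraph V) (M : ℕ) (x : ℕ → V) (Y : Finset V) (a b : V)
    (L : List V) : Prop :=
  a ∈ Y ∧ b ∈ Y ∧ IsPathList (altGraph R M x Y) a b L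

lemma card_usedIdx_append {L K : List V} (hd : L.Disjoint K) :
    (usedIdx M x (L ++ K)).card = (usedIdx M x L).card + (usedIdx M x K).card := by
  rw [← Finset.card_union_of_disjoint]
  · congr 1
    ext i
    simp [usedIdx, and_or_left]
  · rw [Finset.disjoint_left]
    intro i h1 h2
    simp only [usedIdx, Finset.mem_filter] at h1 h2
    exact hd h1.2 h2.2

lemma card_filter_mem_append {L K : List V} (hd : L.Disjoint K) :
    (Y.filter (· ∈ L ++ K)).card = (Y.filter (· ∈ L)).card + (Y.filter (· ∈ K)).card := by
  rw [← Finset.card_union_of_disjoint]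
  · congr 1
    ext i
    simp [and_or_left]
  · rw [Finset.disjoint_left]
    intro i h1 h2
    simp only [Finset.mem_filter] at h1 h2
    exact hd h1.2 h2.2

namespace Config

lemma card_usedIdx_singleton (h : Config R B M x Y) {i : ℕ} (hi : i < M) :
    (usedIdx M x [x i]).card = 1 ∧ (Y.filter (· ∈ [x i])).card = 0 := by
  constructor
  · rw [Finset.card_eq_one]
    refine ⟨i, ?_⟩
    ext j
    simp only [usedIdx, Finset.mem_filter, Finset.mem_range, List.mem_singleton,
      Finset.mem_singleton]
    exact ⟨fun hj => h.inj _ _ hj.1 hi hj.2, by rintro rfl; exact ⟨hi, rfl⟩⟩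
  · rw [Finset.card_eq_zero, Finset.filter_eq_empty_iff]
    intro y hy hyx
    exact h.disj i hi (by simpa [List.mem_singleton.1 hyx] using hy)

lemma card_filter_singleton (h : Config R B M x Y) {y : V} (hy : y ∈ Y) :
    (usedIdx M x [y]).card = 0 ∧ (Y.filter (· ∈ [y])).card = 1 := by
  constructor
  · rw [Finset.card_eq_zero, usedIdx, Finset.filter_eq_empty_iff]
    intro i hi hiy
    exact h.ne_of_mem hy i (by simpa using hi) (by simpa using hiy)
  · rw [Finset.card_eq_one]
    refine ⟨y, ?_⟩
    ext z
    simp only [Finset.mem_filter, List.mem_singleton, Finset.mem_singleton]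
    exact ⟨fun hz => hz.2, by rintro rfl; exact ⟨hy, rfl⟩⟩

lemma card_of_altGraph (h : Config R B M x Y) {b : V} (hb : b ∈ Y) :
    ∀ (L : List V) (a : V), IsPathList (altGraph R M x Y) a b L →
      (a ∈ Y → (usedIdx M x L).card + 1 = (Y.filter (· ∈ L)).card) ∧
      (a ∉ Y → (usedIdx M x L).card = (Y.filter (· ∈ L)).card) ∧
      L.length = (usedIdx M x L).card + (Y.filter (· ∈ L)).card
  | [], a, hL => by simpa using hL.length_pos
  | [v], a, hL => by
    obtain rfl : v = a := by simpa using hL.2.2.1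
    obtain rfl : v = b := by simpa using hL.2.2.2
    obtain ⟨h1, h2⟩ := h.card_filter_singleton hb
    simp only [h1, h2, List.length_singleton]
    tauto
  | v :: w :: L, a, hL => by
    obtain ⟨rfl, hvw, hv, hL'⟩ := hL.cons_inv
    obtain ⟨ih1, ih2, ih3⟩ := h.card_of_altGraph hb (w :: L) w hL'
    have hd : List.Disjoint [a] (w :: L) := by simpa using hv
    have e : a :: w :: L = [a] ++ (w :: L) := rfl
    rw [e, card_usedIdx_append hd, card_filter_mem_append hd, List.length_append, ih3]
    rcases hvw.2 with ⟨ha, i, hi, hix⟩ | ⟨hw, i, hi, hix⟩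
    · obtain ⟨h1, h2⟩ := h.card_filter_singleton ha
      have := ih2 (hix ▸ h.disj i hi)
      rw [h1, h2, List.length_singleton]
      exact ⟨fun _ => by omega, fun h' => absurd ha h', by omega⟩
    · obtain ⟨h1, h2⟩ := h.card_usedIdx_singleton hi
      rw [hix] at h1 h2
      have := ih1 hw
      rw [h1, h2, List.length_singleton]
      exact ⟨fun h' => absurd h' (hix ▸ h.disj i hi), fun _ => by omega, by omega⟩

end Config

namespace IsAlternating

variable {a b c d : V} {L K : List V} {i j : ℕ}

lemma singleton (R : SimpleGraph V) (M : ℕ) (x : ℕ → V) (ha : a ∈ Y) :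
    IsAlternating R M x Y a a [a] :=
  ⟨ha, ha, IsPathList.singleton _ _⟩

lemma reverse (h : IsAlternating R M x Y a b L) : IsAlternating R M x Y b a L.reverse :=
  ⟨h.2.1, h.1, h.2.2.reverse⟩

lemma red (h : IsAlternating R M x Y a b L) : IsPathList R a b L := h.2.2.mono altGraph_le

lemma card_used (hL : IsAlternating R M x Y a b L) (h : Config R B M x Y) :
    (usedIdx M x L).card + 1 = (Y.filter (· ∈ L)).card :=
  (h.card_of_altGraph hL.2.1 L a hL.2.2).1 hL.1

lemma length_eq (hL : IsAlternating R M x Y a b L) (h : Config R B M x Y) :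
    L.length = (usedIdx M x L).card + (Y.filter (· ∈ L)).card :=
  (h.card_of_altGraph hL.2.1 L a hL.2.2).2.2

lemma join (hL : IsAlternating R M x Y a b L) (hK : IsAlternating R M x Y c d K)
    (hd : L.Disjoint K) (hi : i < M) (hiL : x i ∉ L) (hiK : x i ∉ K) (h1 : R.Adj b (x i))
    (h2 : R.Adj c (x i)) :
    ∃ N, IsAlternating R M x Y a d N ∧ N.length = L.length + K.length + 1 ∧
      ∀ v ∈ N, v ∈ L ∨ v ∈ K ∨ v = x i := by
  have p1 := hL.2.2.concat (v := x i) ⟨h1, Or.inl ⟨hL.2.1, i, hi, rfl⟩⟩ hiL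
  have p2 := p1.append hK.2.2 ⟨h2.symm, Or.inr ⟨hK.1, i, hi, rfl⟩⟩ (by
    rw [List.disjoint_append_left]
    exact ⟨hd, by simpa using hiK⟩)
  refine ⟨_, ⟨hL.1, hK.2.1, p2⟩, by simp; omega, ?_⟩
  intro v hv
  simp at hv
  tauto

/-- If the ends of an alternating path have a common red neighbour, the path closes to a cycle, and
this cycle can be opened at any of its vertices. -/
lemma exists_rotation (hL : IsAlternating R M x Y a b L) (hi : i < M) (hiL : x i ∉ L)
    (h1 : R.Adj a (x i)) (h2 : R.Adj b (x i)) {v : V} (hv : v ∈ L) :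
    ∃ u K, IsPathList (altGraph R M x Y) v u K ∧ K.Perm (L ++ [x i]) ∧
      (altGraph R M x Y).Adj u v :=
  (hL.2.2.concat (v := x i) ⟨h2, Or.inl ⟨hL.2.1, i, hi, rfl⟩⟩ hiL).rotate
    ⟨h1.symm, Or.inr ⟨hL.1, i, hi, rfl⟩⟩ (List.mem_append_left _ hv)

/-- If an alternating path closes to a cycle and a vertex `x j` of it has a red neighbour in `Y` that
starts a disjoint alternating path, the cycle opened at `x j` can be continued by this path. -/
lemma exists_longer (hL : IsAlternating R M x Y a b L) (h : Config R B M x Y)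
    (hK : IsAlternating R M x Y c d K) (hd : L.Disjoint K) (hi : i < M) (hiL : x i ∉ L)
    (hiK : x i ∉ K) (h1 : R.Adj a (x i)) (h2 : R.Adj b (x i)) (hj : j < M) (hjL : x j ∈ L)
    (h3 : R.Adj c (x j)) :
    ∃ u N, IsAlternating R M x Y u d N ∧ N.length = L.length + K.length + 1 := by
  obtain ⟨u, N, hN, hperm, hu⟩ := hL.exists_rotation hi hiL h1 h2 hjL
  have huY : u ∈ Y := by
    rcases hu.2 with h' | h'
    · exact h'.1
    · exact absurd h'.1 (h.disj j hj)
  refine ⟨u, _, ⟨huY, hK.2.1, hN.reverse.append hK.2.2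
    ⟨h3.symm, Or.inr ⟨hK.1, j, hj, rfl⟩⟩ ?_⟩, ?_⟩
  · intro v hv hvK
    rw [List.mem_reverse, hperm.mem_iff, List.mem_append, List.mem_singleton] at hv
    rcases hv with hv | rfl
    · exact hd hv hvK
    · exact hiK hvK
  · simp [hperm.length_eq]; omega

lemma ends_ne (hL : IsAlternating R M x Y a b L) (h1 : 1 < L.length) : a ≠ b :=
  hL.2.2.left_ne_right h1

end IsAlternating

namespace Config

/-- Three vertices of `Y` without free common red neighbours force the first vertex of the path to
be used, since at most one of them misses it. -/
lemma first_mem (h : Config R B M x Y) {L : List V} {p q r : V}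
    (hp : p ∈ Y) (hq : q ∈ Y) (hr : r ∈ Y) (hpq : p ≠ q) (hpr : p ≠ r) (hqr : q ≠ r)
    (npq : NoCommon R M x L p q) (npr : NoCommon R M x L p r) (nqr : NoCommon R M x L q r) :
    x 0 ∈ L := by
  by_contra hL
  have m1 := npq 0 h.pos hL
  have m2 := npr 0 h.pos hL
  have m3 := nqr 0 h.pos hL
  have r1 := h.red_first hp
  have r2 := h.red_first hq
  have r3 := h.red_first hr
  by_cases h1 : Missing R B p (x 0)
  · exact m3 (r2 fun h2 => hpq (h.miss_left h1 h2)) (r3 fun h2 => hpr (h.miss_left h1 h2))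
  · by_cases h2 : Missing R B q (x 0)
    · exact m2 (r1 h1) (r3 fun h3 => hqr (h.miss_left h2 h3))
    · exact m1 (r1 h1) (r2 h2)

lemma last_mem (h : Config R B M x Y) {L : List V} {p q r : V}
    (hp : p ∈ Y) (hq : q ∈ Y) (hr : r ∈ Y) (hpq : p ≠ q) (hpr : p ≠ r) (hqr : q ≠ r)
    (npq : NoCommon R M x L p q) (npr : NoCommon R M x L p r) (nqr : NoCommon R M x L q r) :
    x (M - 1) ∈ L := by
  have key : ∀ {p q}, NoCommon R M x L p q → NoCommon R M (fun i => x (M - 1 - i)) L p q :=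
    fun hn i hi => hn _ (by omega)
  have := h.reverse.first_mem hp hq hr hpq hpr hqr (key npq) (key npr) (key nqr)
  simpa using this

end Config

/-- `W` is a longest alternating path and `W'` is a longest alternating path disjoint from `W`. -/
structure LongestPair (R : SimpleGraph V) (M : ℕ) (x : ℕ → V) (Y : Finset V) (a b c d : V)
    (W W' : List V) : Prop where
  alt : IsAlternating R M x Y a b W
  alt' : IsAlternating R M x Y c d W'
  disj : W.Disjoint W'
  le : ∀ p q L, IsAlternating R M x Y p q L → L.length ≤ W.length
  le' : ∀ p q L, IsAlternating R M x Y p q L → W.Disjoint L → L.length ≤ W'.length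

namespace LongestPair

variable {a b c d y : V} {W W' : List V} {i k : ℕ}

lemma reverse_left (P : LongestPair R M x Y a b c d W W') :
    LongestPair R M x Y b a c d W.reverse W' where
  alt := P.alt.reverse
  alt' := P.alt'
  disj := by simpa using P.disj
  le := by simpa using P.le
  le' := by simpa using P.le'

lemma reverse_right (P : LongestPair R M x Y a b c d W W') :
    LongestPair R M x Y a b d c W W'.reverse where
  alt := P.alt
  alt' := P.alt'.reverse
  disj := by simpa using P.disj
  le := P.le
  le' := by simpa using P.le'

lemma length_le (P : LongestPair R M x Y a b c d W W') : W'.length ≤ W.length :=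
  P.le _ _ _ P.alt'

lemma noCommon_aux (P : LongestPair R M x Y a b c d W W') :
    NoCommon R M x (W ++ W') b c := by
  intro i hi hiL hb hc
  rw [List.mem_append, not_or] at hiL
  obtain ⟨N, hN, hlen, -⟩ := P.alt.join P.alt' P.disj hi hiL.1 hiL.2 hb hc
  have := P.le _ _ _ hN
  omega

lemma noCommon_congr {L K : List V} {p q : V} (hLK : ∀ v, v ∈ L ↔ v ∈ K)
    (h : NoCommon R M x L p q) : NoCommon R M x K p q :=
  fun i hi hK => h i hi ((hLK _).not.2 hK)

/-- No end of `W` has a free common red neighbour with an end of `W'`. -/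
lemma noCommon (P : LongestPair R M x Y a b c d W W') {p q : V} (hp : p = a ∨ p = b)
    (hq : q = c ∨ q = d) : NoCommon R M x (W ++ W') p q := by
  rcases hp with rfl | rfl <;> rcases hq with rfl | rfl
  · exact noCommon_congr (by simp) P.reverse_left.noCommon_aux
  · exact noCommon_congr (by simp) P.reverse_left.reverse_right.noCommon_aux
  · exact noCommon_congr (by simp) P.noCommon_aux
  · exact noCommon_congr (by simp) P.reverse_right.noCommon_aux

/-- No end of `W` or `W'` has a free common red neighbour with an uncovered vertex of `Y`. -/
lemma noCommon_right (P : LongestPair R M x Y a b c d W W') (hy : y ∈ Y) (hyW : y ∉ W)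
    (hyW' : y ∉ W') {p : V} (hp : p = a ∨ p = b ∨ p = c) : NoCommon R M x (W ++ W') p y := by
  intro i hi hiL h1 h2
  rw [List.mem_append, not_or] at hiL
  have hyi := (h2.ne).symm
  have hs := IsAlternating.singleton R M x hy
  have key : ∀ {p q L}, IsAlternating R M x Y q p L → y ∉ L → x i ∉ L → R.Adj p (x i) →
      ∃ q' N, IsAlternating R M x Y q q' N ∧ N.length = L.length + 2 ∧
        ∀ v ∈ N, v ∈ L ∨ v = y ∨ v = x i := by
    intro p q L hL hyL hiL hp
    obtain ⟨N, hN, hlen, hmem⟩ := hL.join hs (by simpa using hyL) hi hiL (by simpa using hyi) hp h2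
    exact ⟨_, N, hN, by simp at hlen; omega, by simpa using hmem⟩
  rcases hp with rfl | rfl | rfl
  · obtain ⟨q', N, hN, hlen, -⟩ := key P.alt.reverse (by simpa using hyW) (by simpa using hiL.1) h1
    have := P.le _ _ _ hN
    simp at hlen
    omega
  · obtain ⟨q', N, hN, hlen, -⟩ := key P.alt hyW hiL.1 h1
    have := P.le _ _ _ hN
    omega
  · obtain ⟨q', N, hN, hlen, hmem⟩ := key P.alt'.reverse (by simpa using hyW')
      (by simpa using hiL.2) h1
    have := P.le' _ _ _ hN (by
      intro v hv hvN
      rcases hmem v hvN with h' | rfl | rfl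
      · exact P.disj hv (by simpa using h')
      · exact hyW hv
      · exact hiL.1 hv)
    simp at hlen
    omega

lemma one_lt_length (P : LongestPair R M x Y a b c d W W')
    {v : V} (hv : v ∉ Y) (hvW : v ∈ W ++ W') : 1 < W.length := by
  by_contra hcon
  have hl := P.length_le
  obtain ⟨u, hu⟩ : ∃ u, W = [u] := List.length_eq_one_iff.1 (by
    have := P.alt.2.2.length_pos; omega)
  obtain ⟨u', hu'⟩ : ∃ u, W' = [u] := List.length_eq_one_iff.1 (by
    have := P.alt'.2.2.length_pos; omega)
  have e1 := P.alt.2.2.left_mem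
  have e2 := P.alt'.2.2.left_mem
  rw [hu] at e1 hvW
  rw [hu'] at e2 hvW
  simp only [List.mem_singleton] at e1 e2
  subst e1 e2
  have hvW' : v = a ∨ v = c := by simpa using hvW
  rcases hvW' with rfl | rfl
  · exact hv P.alt.1
  · exact hv P.alt'.1

/-- Two greedily chosen longest alternating paths cover `Y`. -/
lemma cover (P : LongestPair R M x Y a b c d W W') (h : Config R B M x Y)
    (hM : 2 * Y.card ≤ M + 1) (hM2 : 2 ≤ M) (hy : y ∈ Y) : y ∈ W ++ W' := by
  by_contra hcon
  have hyW := hcon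
  rw [List.mem_append, not_or] at hyW
  have nac := P.noCommon (Or.inl rfl) (Or.inl rfl)
  have nbc := P.noCommon (Or.inr rfl) (Or.inl rfl)
  have nay := P.noCommon_right hy hyW.1 hyW.2 (Or.inl rfl)
  have nby := P.noCommon_right hy hyW.1 hyW.2 (Or.inr (Or.inl rfl))
  have ncy := P.noCommon_right hy hyW.1 hyW.2 (Or.inr (Or.inr rfl))
  have aW := P.alt.2.2.left_mem
  have bW := P.alt.2.2.right_mem
  have cW := P.alt'.2.2.left_mem
  have hac : a ≠ c := fun e => P.disj aW (e ▸ cW)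
  have hay : a ≠ y := fun e => hyW.1 (e ▸ aW)
  have hcy : c ≠ y := fun e => hyW.2 (e ▸ cW)
  have h0 := h.first_mem P.alt.1 P.alt'.1 hy hac hay hcy nac nay ncy
  have h1 := h.last_mem P.alt.1 P.alt'.1 hy hac hay hcy nac nay ncy
  have hab := P.alt.ends_ne (P.one_lt_length (h.disj 0 h.pos) h0)
  have hE := le_card_freeEdges hM2 h0 h1
  have hU := card_usedIdx_append (M := M) (x := x) P.disj
  have hYW := card_filter_mem_append (Y := Y) P.disj
  have u1 := P.alt.card_used h
  have u2 := P.alt'.card_used h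
  have hlt : (Y.filter (· ∈ W ++ W')).card < Y.card := by
    apply Finset.card_lt_card
    rw [Finset.filter_ssubset]
    exact ⟨y, hy, hcon⟩
  have s1 := h.freeEdges_subset_of_three P.alt.1 P.alt'.1 hy nac nay ncy
  have s2 := h.freeEdges_subset_of_three P.alt.2.1 P.alt'.1 hy nbc nby ncy
  have s3 : freeEdges M x (W ++ W') ⊆
      (missEdges R B M x (W ++ W') a ∩ missEdges R B M x (W ++ W') b) ∪
      (missEdges R B M x (W ++ W') c ∪ missEdges R B M x (W ++ W') y) := by
    rw [Finset.inter_union_distrib_right]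
    exact Finset.subset_inter s1 s2
  have := Finset.card_le_card s3
  have t1 := Finset.card_union_le
    (missEdges R B M x (W ++ W') a ∩ missEdges R B M x (W ++ W') b)
    (missEdges R B M x (W ++ W') c ∪ missEdges R B M x (W ++ W') y)
  have t2 := Finset.card_union_le
    (missEdges R B M x (W ++ W') c) (missEdges R B M x (W ++ W') y)
  have t3 := h.card_missEdges_inter_le (W ++ W') hab
  have t4 := h.card_missEdges_le (W ++ W') c
  have t5 := h.card_missEdges_le (W ++ W') y
  omega

end LongestPair

lemma altGraph_reverse :
    altGraph R M (fun i => x (M - 1 - i)) Y = altGraph R M x Y := by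
  have key : ∀ b, (∃ i < M, x (M - 1 - i) = b) ↔ ∃ i < M, x i = b := by
    intro b
    constructor
    · rintro ⟨i, hi, rfl⟩
      exact ⟨M - 1 - i, by omega, rfl⟩
    · rintro ⟨i, hi, rfl⟩
      exact ⟨M - 1 - i, by omega, by congr 1; omega⟩
  ext a b
  simp only [altGraph, key]

lemma isAlternating_reverse {a b : V} {L : List V} :
    IsAlternating R M (fun i => x (M - 1 - i)) Y a b L ↔ IsAlternating R M x Y a b L := by
  rw [IsAlternating, IsAlternating, altGraph_reverse]

end Alternating

/-! ### One alternating path through all of `Y` -/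

section OnePath

open scoped Classical

variable {V : Type*} {R B : SimpleGraph V} {M : ℕ} {x : ℕ → V} {Y : Finset V}
variable {a b : V} {W : List V} {i j l : ℕ}

/-- Three vertices of `Y` cannot all miss an end of the same edge of the path. -/
lemma Config.exists_red_of_three (h : Config R B M x Y) {p q r : V} (hp : p ∈ Y) (hq : q ∈ Y)
    (hr : r ∈ Y) (hpq : p ≠ q) (hpr : p ≠ r) (hqr : q ≠ r) (hl : l + 1 < M) :
    ∃ v ∈ Y, R.Adj v (x l) ∨ R.Adj v (x (l + 1)) := by
  by_contra! hcon
  have key : ∀ v ∈ Y, Missing R B v (x l) ∨ Missing R B v (x (l + 1)) := by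
    intro v hv
    by_contra! hm
    have := h.red_or_red hv hl hm.1 hm.2
    have := hcon v hv
    tauto
  rcases key p hp with h1 | h1 <;> rcases key q hq with h2 | h2 <;> rcases key r hr with h3 | h3
  · exact hpq (h.miss_left h1 h2)
  · exact hpq (h.miss_left h1 h2)
  · exact hpr (h.miss_left h1 h3)
  · exact hqr (h.miss_left h2 h3)
  · exact hqr (h.miss_left h2 h3)
  · exact hpr (h.miss_left h1 h3)
  · exact hpq (h.miss_left h1 h2)
  · exact hpq (h.miss_left h1 h2)

namespace IsAlternating

lemma length_of_cover (hW : IsAlternating R M x Y a b W) (h : Config R B M x Y)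
    (hcov : ∀ y ∈ Y, y ∈ W) :
    (usedIdx M x W).card + 1 = Y.card ∧ W.length + 1 = 2 * Y.card := by
  have h1 := hW.card_used h
  have h2 := hW.length_eq h
  rw [Finset.filter_true_of_mem hcov] at h1 h2
  omega

/-- An alternating path through all of `Y` can be continued at one of its ends. -/
lemma exists_red_path_even (hW : IsAlternating R M x Y a b W) (h : Config R B M x Y)
    (hcov : ∀ y ∈ Y, y ∈ W) (hk : 2 ≤ Y.card) (hM : 2 * Y.card ≤ M + 1) :
    ∃ p q L, IsPathList R p q L ∧ 2 * Y.card ≤ L.length := by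
  obtain ⟨hu, hlen⟩ := hW.length_of_cover h hcov
  have hab := hW.ends_ne (by omega)
  by_cases hex : ∃ i < M, x i ∉ W ∧ (R.Adj a (x i) ∨ R.Adj b (x i))
  · obtain ⟨i, hi, hiW, hr | hr⟩ := hex
    · exact ⟨_, _, _, hW.red.cons hr.symm hiW, by simp; omega⟩
    · exact ⟨_, _, _, hW.red.concat hr hiW, by simp; omega⟩
  exfalso
  push Not at hex
  have h0 : x 0 ∈ W := by
    by_contra h0
    obtain ⟨r1, r2⟩ := hex 0 h.pos h0
    have m1 := mt (h.red_first hW.1) r1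
    have m2 := mt (h.red_first hW.2.1) r2
    rw [not_not] at m1 m2
    exact hab (h.miss_left m1 m2)
  have h1 : x (M - 1) ∈ W := by
    by_contra h0
    obtain ⟨r1, r2⟩ := hex (M - 1) (by omega) h0
    have m1 := mt (h.red_last hW.1) r1
    have m2 := mt (h.red_last hW.2.1) r2
    rw [not_not] at m1 m2
    exact hab (h.miss_left m1 m2)
  have hE := le_card_freeEdges (by omega) h0 h1
  have hsub : freeEdges M x W ⊆ missEdges R B M x W a ∩ missEdges R B M x W b := by
    intro i hi
    have hf := mem_freeEdges.1 hi
    have e1 := hex i (by omega) hf.2.1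
    have e2 := hex (i + 1) (by omega) hf.2.2
    rw [Finset.mem_inter]
    constructor
    · by_contra hcon
      exact (h.red_or_red' hW.1 hi hcon).elim e1.1 e2.1
    · by_contra hcon
      exact (h.red_or_red' hW.2.1 hi hcon).elim e1.2 e2.2
  have := Finset.card_le_card hsub
  have := h.card_missEdges_inter_le W hab
  omega

lemma exists_red_path_of_ends (hW : IsAlternating R M x Y a b W) (h : Config R B M x Y)
    (hi : i < M) (hj : j < M) (hij : i ≠ j) (hiW : x i ∉ W) (hjW : x j ∉ W)
    (h1 : R.Adj a (x i)) (h2 : R.Adj b (x j)) :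
    ∃ p q L, IsPathList R p q L ∧ L.length = W.length + 2 := by
  refine ⟨_, _, _, (hW.red.cons h1.symm hiW).concat h2 ?_, by simp⟩
  rw [List.mem_cons, not_or]
  exact ⟨fun e => hij (h.inj _ _ hi hj e.symm), hjW⟩

/-- If the ends of an alternating path through all of `Y` have a free common red neighbour, the
resulting cycle can be opened at any vertex of `Y`, and one of three vertices of `Y` has a
red neighbour outside the cycle. -/
lemma exists_red_path_of_cycle (hW : IsAlternating R M x Y a b W) (h : Config R B M x Y)
    (hcov : ∀ y ∈ Y, y ∈ W) (hk : 3 ≤ Y.card) (hi : i < M) (hiW : x i ∉ W)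
    (h1 : R.Adj a (x i)) (h2 : R.Adj b (x i)) (hl : l ∈ freeEdges M x (W ++ [x i])) :
    ∃ p q L, IsPathList R p q L ∧ L.length = W.length + 2 := by
  obtain ⟨p, q, r, hp, hq, hr, hpq, hpr, hqr⟩ := Finset.two_lt_card_iff.1 hk
  have hf := mem_freeEdges.1 hl
  have key : ∀ v ∈ Y, ∀ t < M, x t ∉ W ++ [x i] → R.Adj v (x t) →
      ∃ p q L, IsPathList R p q L ∧ L.length = W.length + 2 := by
    intro v hv t ht htW hvt
    obtain ⟨u, K, hK, hperm, -⟩ := hW.exists_rotation hi hiW h1 h2 (hcov v hv)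
    refine ⟨_, _, _, (hK.mono altGraph_le).cons hvt.symm ?_, ?_⟩
    · rwa [hperm.mem_iff]
    · simp [hperm.length_eq]
  obtain ⟨v, hv, hvl | hvl⟩ := h.exists_red_of_three hp hq hr hpq hpr hqr hf.1
  · exact key v hv l (by omega) hf.2.1 hvl
  · exact key v hv (l + 1) (by omega) hf.2.2 hvl

/-- The case of four path vertices: `W` has the vertices `a`, `x 3`, `b`. -/
lemma exists_red_path_of_four (hW : IsAlternating R M x Y a b W) (h : Config R B M x Y)
    (hM : M = 4) (h0 : x 0 ∉ W) (h2W : x 2 ∉ W) (ha : R.Adj a (x 0))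
    (m1 : Missing R B a (x 1)) (m2 : Missing R B b (x 2)) (na : ¬ R.Adj a (x 2))
    (nb : ¬ R.Adj b (x 1)) (hab : a ≠ b) :
    ∃ p q L, IsPathList R p q L ∧ L.length = W.length + 2 := by
  subst hM
  have ne : ∀ i j, i < 4 → j < 4 → i ≠ j → x i ≠ x j :=
    fun i j hi hj hij e => hij (h.inj i j hi hj e)
  have na' := h.ne_of_mem hW.1
  have nb' := h.ne_of_mem hW.2.1
  have ba : B.Adj a (x 2) := by
    rcases adj_or_missing (R := R) (B := B) (na' 2 (by omega)).symm with h' | h' | h'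
    · exact absurd h' na
    · exact h'
    · exact absurd (h.miss _ _ _ m1 h') (ne 1 2 (by omega) (by omega) (by omega))
  have bb : B.Adj b (x 1) := by
    rcases adj_or_missing (R := R) (B := B) (nb' 1 (by omega)).symm with h' | h' | h'
    · exact absurd h' nb
    · exact h'
    · exact absurd (h.miss _ _ _ h' m2) (ne 1 2 (by omega) (by omega) (by omega))
  rcases adj_or_missing (R := R) (B := B) (ne 2 0 (by omega) (by omega) (by omega))
    with h' | h' | h'
  · refine ⟨_, _, _, (hW.red.cons ha.symm h0).cons h' ?_, by simp⟩
    rw [List.mem_cons, not_or]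
    exact ⟨ne 2 0 (by omega) (by omega) (by omega), h2W⟩
  · exfalso
    have hp : IsPathList B b a [b, x 1, x 0, x 2, a] := by
      refine ⟨?_, ?_, rfl, rfl⟩
      · have := h.chain 0 (by omega)
        simp [bb, this.symm, h'.symm, ba.symm]
      · have := ne 1 0 (by omega) (by omega) (by omega)
        have := ne 1 2 (by omega) (by omega) (by omega)
        have := ne 0 2 (by omega) (by omega) (by omega)
        have := na' 0 (by omega)
        have := na' 1 (by omega)
        have := na' 2 (by omega)
        have := (nb' 0 (by omega)).symm
        have := (nb' 1 (by omega)).symm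
        have := (nb' 2 (by omega)).symm
        simp_all [eq_comm]
    have := h.le _ _ _ hp
    simp at this
  · exact absurd (h.miss _ _ _ h' m2.symm) (nb' 0 (by omega))

/-- The case that exactly one end of the blue path is used. Unless the ends of `W` extend to different
free vertices, both are red to `x 0` only, and `W` closes to a cycle. -/
lemma exists_red_path_of_first (hW : IsAlternating R M x Y a b W) (h : Config R B M x Y)
    (hcov : ∀ y ∈ Y, y ∈ W) (hk : 2 ≤ Y.card) (hM : 2 * Y.card ≤ M) (h0 : x 0 ∉ W)
    (h1 : x (M - 1) ∈ W) : ∃ p q L, IsPathList R p q L ∧ L.length = W.length + 2 := by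
  obtain ⟨hu, hlen⟩ := hW.length_of_cover h hcov
  have hab := hW.ends_ne (by omega)
  by_contra hcon
  have hends : ∀ {i j}, i < M → j < M → x i ∉ W → x j ∉ W → R.Adj a (x i) → R.Adj b (x j) →
      i = j := by
    intro i j hi hj hiW hjW hai hbj
    by_contra hij
    exact hcon (hW.exists_red_path_of_ends h hi hj hij hiW hjW hai hbj)
  have hE := le_card_freeEdges (M := M) (x := x) (L := W ++ [x 0]) (by omega) (by simp) (by simp [h1])
  rw [card_usedIdx_append (by simpa using h0), (h.card_usedIdx_singleton h.pos).1] at hE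
  have hmem : ∀ l ∈ freeEdges M x (W ++ [x 0]), l + 1 < M ∧ x l ∉ W ∧ x (l + 1) ∉ W ∧
      l ≠ 0 ∧ x l ≠ x 0 ∧ x (l + 1) ≠ x 0 := by
    intro l hl
    have := mem_freeEdges.1 hl
    simp only [List.mem_append, List.mem_singleton, not_or] at this
    exact ⟨this.1, this.2.1.1, this.2.2.1, fun e => this.2.1.2 (by rw [e]), this.2.1.2,
      this.2.2.2⟩
  obtain ⟨l, hl⟩ : (freeEdges M x (W ++ [x 0])).Nonempty := by
    rw [← Finset.card_pos]
    omega
  obtain ⟨hlM, hlW, hlW', hl0, hlx, hlx'⟩ := hmem l hl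
  have ra : R.Adj a (x 0) := by
    by_contra hna
    have ma := not_not.1 (mt (h.red_first hW.1) hna)
    have rb : R.Adj b (x 0) := h.red_first hW.2.1 fun mb => hab (h.miss_left ma mb)
    rcases h.red_or_red hW.1 hlM (fun m => hlx (h.miss _ _ _ m ma))
      (fun m => hlx' (h.miss _ _ _ m ma)) with hr | hr
    · exact hl0 (hends (by omega) h.pos hlW h0 hr rb)
    · exact absurd (hends (by omega) h.pos hlW' h0 hr rb) (by omega)
  have rb : R.Adj b (x 0) := by
    by_contra hnb
    have mb := not_not.1 (mt (h.red_first hW.2.1) hnb)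
    rcases h.red_or_red hW.2.1 hlM (fun m => hlx (h.miss _ _ _ m mb))
      (fun m => hlx' (h.miss _ _ _ m mb)) with hr | hr
    · exact hl0 (hends h.pos (by omega) h0 hlW ra hr).symm
    · exact absurd (hends h.pos (by omega) h0 hlW' ra hr) (by omega)
  rcases Nat.lt_or_ge Y.card 3 with hk3 | hk3
  · -- Here `Y = {a, b}` and there is only one free edge, whose ends are missed by `a` and `b`.
    have nra : ∀ i < M, i ≠ 0 → x i ∉ W → ¬ R.Adj a (x i) := fun i hi hi0 hiW hr =>
      hi0 (hends hi h.pos hiW h0 hr rb)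
    have nrb : ∀ i < M, i ≠ 0 → x i ∉ W → ¬ R.Adj b (x i) := fun i hi hi0 hiW hr =>
      hi0 (hends h.pos hi h0 hiW ra hr).symm
    have hsub : freeEdges M x (W ++ [x 0]) ⊆
        missEdges R B M x (W ++ [x 0]) a ∩ missEdges R B M x (W ++ [x 0]) b := by
      intro i hi
      obtain ⟨hiM, hiW, hiW', hi0, -, -⟩ := hmem i hi
      rw [Finset.mem_inter]
      constructor
      · by_contra hn
        exact (h.red_or_red' hW.1 hi hn).elim (nra i (by omega) hi0 hiW)
          (nra (i + 1) hiM (by omega) hiW')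
      · by_contra hn
        exact (h.red_or_red' hW.2.1 hi hn).elim (nrb i (by omega) hi0 hiW)
          (nrb (i + 1) hiM (by omega) hiW')
    have hle := (Finset.card_le_card hsub).trans (h.card_missEdges_inter_le _ hab)
    have hM4 : M = 4 := by omega
    have hl1 : l = 1 := by
      have : l + 1 ≠ M - 1 := fun e => hlW' (by rw [e]; exact h1)
      omega
    subst hl1
    have hl' := Finset.mem_inter.1 (hsub hl)
    rw [mem_missEdges, mem_missEdges] at hl'
    obtain ⟨⟨-, ma⟩, -, mb⟩ := hl'
    rcases ma with ma | ma <;> rcases mb with mb | mb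
    · exact hab (h.miss_left ma mb)
    · exact hcon (hW.exists_red_path_of_four h hM4 h0 hlW' ra ma mb
        (nra 2 (by omega) (by omega) hlW') (nrb 1 (by omega) (by omega) hlW) hab)
    · obtain ⟨p, q, L, hL, hLl⟩ := hW.reverse.exists_red_path_of_four h hM4 (by simpa using h0)
        (by simpa using hlW') rb mb ma (nrb 2 (by omega) (by omega) hlW')
        (nra 1 (by omega) (by omega) hlW) hab.symm
      exact hcon ⟨p, q, L, hL, by simpa using hLl⟩
    · exact hab (h.miss_left ma mb)
  · exact hcon (hW.exists_red_path_of_cycle h hcov hk3 h.pos h0 ra rb hl)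

/-- An alternating path through all of `Y` extends to a red path with two more vertices. -/
lemma exists_red_path_odd (hW : IsAlternating R M x Y a b W) (h : Config R B M x Y)
    (hcov : ∀ y ∈ Y, y ∈ W) (hk : 2 ≤ Y.card) (hM : 2 * Y.card ≤ M) :
    ∃ p q L, IsPathList R p q L ∧ 2 * Y.card + 1 ≤ L.length := by
  obtain ⟨hu, hlen⟩ := hW.length_of_cover h hcov
  have hab := hW.ends_ne (by omega)
  suffices ∃ p q L, IsPathList R p q L ∧ L.length = W.length + 2 by
    obtain ⟨p, q, L, hL, hl⟩ := this
    exact ⟨p, q, L, hL, by omega⟩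
  by_cases h0 : x 0 ∈ W <;> by_cases h1 : x (M - 1) ∈ W
  · have hE := le_card_freeEdges (by omega) h0 h1
    obtain ⟨i, hi, hiW, hai⟩ := h.exists_red (L := W) hW.1 (by omega)
    obtain ⟨j, hj, hjW, hbj⟩ := h.exists_red (L := W) hW.2.1 (by omega)
    by_cases hij : i = j
    · subst hij
      obtain ⟨l, hl, hl'⟩ := Finset.exists_mem_notMem_of_card_lt_card
        ((card_filter_touch_le h.inj W (x i)).trans_lt (show 2 < (freeEdges M x W).card by omega))
      refine hW.exists_red_path_of_cycle h hcov ?_ hi hiW hai hbj (l := l) ?_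
      · have : ({0, M - 1} : Finset ℕ) ⊆ usedIdx M x W := by
          intro t ht
          simp only [Finset.mem_insert, Finset.mem_singleton] at ht
          rcases ht with rfl | rfl
          · simpa [usedIdx, h0] using h.pos
          · simpa [usedIdx, h1] using h.pos
        have := Finset.card_le_card this
        rw [Finset.card_pair (by omega)] at this
        omega
      · rw [mem_freeEdges] at hl ⊢
        rw [Finset.mem_filter, mem_freeEdges] at hl'
        simp only [List.mem_append, List.mem_singleton]
        tauto
    · exact hW.exists_red_path_of_ends h hi hj hij hiW hjW hai hbj
  · obtain ⟨p, q, L, hL, hl⟩ := (isAlternating_reverse.2 hW).exists_red_path_of_first h.reverse hcov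
      hk hM (by simpa using h1) (by simpa using h0)
    exact ⟨p, q, L, hL, hl⟩
  · exact hW.exists_red_path_of_first h hcov hk hM h0 h1
  · have hne : x 0 ≠ x (M - 1) := fun e => by
      have := h.inj _ _ h.pos (by omega) e
      omega
    by_contra hcon
    have c1 : ¬ (R.Adj a (x 0) ∧ R.Adj b (x (M - 1))) := fun hr =>
      hcon (hW.exists_red_path_of_ends h h.pos (by omega) (by omega) h0 h1 hr.1 hr.2)
    have c2 : ¬ (R.Adj a (x (M - 1)) ∧ R.Adj b (x 0)) := fun hr =>
      hcon (hW.exists_red_path_of_ends h (by omega) h.pos (by omega) h1 h0 hr.1 hr.2)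
    have a0 := h.red_first hW.1
    have a1 := h.red_last hW.1
    have b0 := h.red_first hW.2.1
    have b1 := h.red_last hW.2.1
    by_cases m1 : Missing R B a (x 0)
    · by_cases m2 : Missing R B b (x 0)
      · exact hab (h.miss_left m1 m2)
      · exact c2 ⟨a1 fun m => hne (h.miss _ _ _ m1 m), b0 m2⟩
    · by_cases m2 : Missing R B b (x (M - 1))
      · exact c2 ⟨a1 fun m => hab (h.miss_left m m2), b0 fun m => hne (h.miss _ _ _ m m2)⟩
      · exact c1 ⟨a0 m1, b1 m2⟩

end IsAlternating

end OnePath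

/-! ### Two alternating paths that cover `Y` -/

section TwoPaths

open scoped Classical

variable {V : Type*} {R B : SimpleGraph V} {M : ℕ} {x : ℕ → V} {Y : Finset V}
variable {a b c d : V} {W W' L : List V} {i j l : ℕ}

/-- Of three sets with at most two elements whose union has at least five elements, one has exactly
two elements and is disjoint from the other two. -/
lemma exists_exclusive {S T U : Finset ℕ} (hS : S.card ≤ 2) (hT : T.card ≤ 2) (hU : U.card ≤ 2)
    (h : 5 ≤ (S ∪ (T ∪ U)).card) :
    (S.card = 2 ∧ Disjoint S T ∧ Disjoint S U) ∨ (T.card = 2 ∧ Disjoint T S ∧ Disjoint T U) ∨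
      (U.card = 2 ∧ Disjoint U S ∧ Disjoint U T) := by
  have e1 := Finset.card_union_add_card_inter S (T ∪ U)
  have e2 := Finset.card_union_add_card_inter T U
  have e3 := Finset.card_union_add_card_inter T (S ∪ U)
  have e4 := Finset.card_union_add_card_inter S U
  have e5 := Finset.card_union_add_card_inter U (S ∪ T)
  have e6 := Finset.card_union_add_card_inter S T
  rw [show T ∪ (S ∪ U) = S ∪ (T ∪ U) from Finset.union_left_comm _ _ _] at e3
  rw [show U ∪ (S ∪ T) = S ∪ (T ∪ U) by
    rw [Finset.union_left_comm, Finset.union_comm U T]] at e5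
  simp only [← Finset.card_eq_zero, Finset.disjoint_iff_inter_eq_empty]
  have f1 : (S ∩ T).card ≤ (S ∩ (T ∪ U)).card := Finset.card_le_card (by grind)
  have f2 : (S ∩ U).card ≤ (S ∩ (T ∪ U)).card := Finset.card_le_card (by grind)
  have f3 : (S ∩ T).card ≤ (T ∩ (S ∪ U)).card := Finset.card_le_card (by grind)
  rw [Finset.inter_comm T S, Finset.inter_comm U S, Finset.inter_comm U T]
  have f4 : (S ∩ (T ∪ U)).card ≤ (S ∩ T).card + (S ∩ U).card := by
    rw [Finset.inter_union_distrib_left]; exact Finset.card_union_le _ _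
  omega

namespace Config

lemma not_missing_of_card (h : Config R B M x Y)
    (hc : 0 < (missEdges R B M x L a).card) (hb : b ∈ Y) : ¬ Missing R B a b := by
  obtain ⟨i, hi⟩ := Finset.card_pos.1 hc
  rw [mem_missEdges, mem_freeEdges] at hi
  intro hm
  rcases hi.2 with h' | h'
  · exact h.disj i (by omega) (h.miss _ _ _ hm h' ▸ hb)
  · exact h.disj (i + 1) (by omega) (h.miss _ _ _ hm h' ▸ hb)

/-- Three vertices `q`, `r`, `s` of `Y` without free common red neighbours, of which only `q` misses a
vertex near the free edges `i` and `i + 1`. Then `q` is blue to `x i` and `x (i + 2)`, and `r` or `s`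
is red to `w = x (i + 1)`. If `w` had a red neighbour on a free edge, a red path with one end `r` or
`s` could be prolonged by three vertices; otherwise `q` can take the place of `w` in the blue path
and `w` can be inserted at another free edge. -/
lemma exists_red_path_of_exclusive (h : Config R B M x Y) {q r s : V} {n : ℕ}
    (hq : q ∈ Y) (hr : r ∈ Y) (hs : s ∈ Y) (hqr : NoCommon R M x L q r)
    (hqs : NoCommon R M x L q s) (hrs : NoCommon R M x L r s)
    (hi : i ∈ freeEdges M x L) (hi' : i + 1 ∈ freeEdges M x L)
    (hmq : Missing R B q (x (i + 1)))
    (r1 : i ∉ missEdges R B M x L r) (r2 : i + 1 ∉ missEdges R B M x L r)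
    (s1 : i ∉ missEdges R B M x L s) (s2 : i + 1 ∉ missEdges R B M x L s)
    (hE : 5 ≤ (freeEdges M x L).card)
    (hQ : ∀ p, p = r ∨ p = s → ∃ t ∈ Y, ∃ Q, NoCommon R M x L p t ∧ IsPathList R p t Q ∧
      Q.length = n ∧ ∀ v ∈ Q, v ∈ L) :
    ∃ p t Q, IsPathList R p t Q ∧ Q.length = n + 3 := by
  have hf := mem_freeEdges.1 hi
  have hf' := mem_freeEdges.1 hi'
  have hne : ∀ j l, j < M → l < M → j ≠ l → x j ≠ x l :=
    fun j l hj hl hjl e => hjl (h.inj _ _ hj hl e)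
  have blueOf : ∀ {p j}, p ∈ Y → j < M → ¬ R.Adj p (x j) → ¬ Missing R B p (x j) →
      B.Adj p (x j) := by
    intro p j hp hj h1 h2
    have := adj_or_missing (R := R) (B := B) (h.ne_of_mem hp j hj).symm
    tauto
  have r1' := h.red_or_red' hr hi r1
  have r2' := h.red_or_red' hr hi' r2
  have s1' := h.red_or_red' hs hi s1
  have s2' := h.red_or_red' hs hi' s2
  have hx : ∀ j, x j ∉ L → j < M → R.Adj q (x j) → ¬ R.Adj r (x j) ∧ ¬ R.Adj s (x j) :=
    fun j hL hj hr => ⟨hqr j hj hL hr, hqs j hj hL hr⟩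
  have hw := hrs (i + 1) (by omega) hf.2.2
  have q0 : B.Adj q (x i) := by
    refine blueOf hq (by omega) (fun hr' => ?_)
      fun m => hne i (i + 1) (by omega) (by omega) (by omega) (h.miss _ _ _ m hmq)
    have := hx i hf.2.1 (by omega) hr'
    tauto
  have q2 : B.Adj q (x (i + 2)) := by
    refine blueOf hq (by omega) (fun hr' => ?_)
      fun m => hne (i + 2) (i + 1) (by omega) (by omega) (by omega) (h.miss _ _ _ m hmq)
    have := hx (i + 2) hf'.2.2 (by omega) hr'
    tauto
  obtain ⟨p, hp, hpw⟩ : ∃ p, (p = r ∨ p = s) ∧ R.Adj p (x (i + 1)) := by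
    by_contra! hcon
    have c1 := hcon r (Or.inl rfl)
    have c2 := hcon s (Or.inr rfl)
    exact hrs i (by omega) hf.2.1 (r1'.resolve_right c1) (s1'.resolve_right c2)
  obtain ⟨t, ht, Q, hpt, hQ, hlen, hQL⟩ := hQ p hp
  by_cases hred : ∃ j < M, x j ∉ L ∧ R.Adj (x (i + 1)) (x j)
  · obtain ⟨j, hj, hjL, hwj⟩ := hred
    obtain ⟨l, hl, hlL, htl, hlj⟩ := h.exists_red_ne (L := L) ht (by omega) (x j)
    have n1 : x l ≠ x (i + 1) := fun e =>
      hpt (i + 1) (by omega) hf.2.2 hpw (e ▸ htl)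
    refine ⟨_, _, _, ((hQ.cons hpw.symm fun hm => hf.2.2 (hQL _ hm)).cons hwj.symm ?_).concat htl
      ?_, by simp [hlen]⟩
    · rw [List.mem_cons, not_or]
      exact ⟨hwj.ne.symm, fun hm => hjL (hQL _ hm)⟩
    · rw [List.mem_cons, List.mem_cons, not_or, not_or]
      exact ⟨hlj, n1, fun hm => hlL (hQL _ hm)⟩
  · exfalso
    push Not at hred
    -- Besides `i` and `i + 1` there is a third free edge.
    obtain ⟨l, hl, hl'⟩ := Finset.exists_mem_notMem_of_card_lt_card
      ((Finset.card_le_two (a := i) (b := i + 1)).trans_lt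
        (show 2 < (freeEdges M x L).card by omega))
    rw [Finset.mem_insert, Finset.mem_singleton, not_or] at hl'
    have hfl := mem_freeEdges.1 hl
    have hblue : ∀ j < M, x j ∉ L → j ≠ i + 1 → B.Adj (x (i + 1)) (x j) := by
      intro j hj hjL hji
      rcases adj_or_missing (R := R) (B := B) (hne (i + 1) j (by omega) hj hji.symm)
        with h' | h' | h'
      · exact absurd h' (hred j hj hjL)
      · exact h'
      · exact absurd (h.miss _ _ _ h' hmq.symm) (h.ne_of_mem hq j hj)
    have hrep := h.toIsLongestPath.replace (h.ne_of_mem hq) (i := i) (by omega) q0 q2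
    refine hrep.not_adj_consecutive (v := x (i + 1)) ?_ (i := l) hfl.1 ?_ ?_
    · intro j hj
      split_ifs with hji
      · exact (h.ne_of_mem hq _ (by omega)).symm
      · exact hne _ _ hj (by omega) hji
    · rw [if_neg (by omega)]
      exact hblue _ (by omega) hfl.2.1 (by omega)
    · rw [if_neg (by omega)]
      exact hblue _ (by omega) hfl.2.2 (by omega)

/-- Two edges of a path that contain the vertex missed by `q` are consecutive. -/
lemma exists_red_path_of_card_two (h : Config R B M x Y) {q r s : V} {n : ℕ}
    (hq : q ∈ Y) (hr : r ∈ Y) (hs : s ∈ Y) (hqr : NoCommon R M x L q r)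
    (hqs : NoCommon R M x L q s) (hrs : NoCommon R M x L r s)
    (hcard : (missEdges R B M x L q).card = 2)
    (hdr : Disjoint (missEdges R B M x L q) (missEdges R B M x L r))
    (hds : Disjoint (missEdges R B M x L q) (missEdges R B M x L s))
    (hE : 5 ≤ (freeEdges M x L).card)
    (hQ : ∀ p, p = r ∨ p = s → ∃ t ∈ Y, ∃ Q, NoCommon R M x L p t ∧ IsPathList R p t Q ∧
      Q.length = n ∧ ∀ v ∈ Q, v ∈ L) :
    ∃ p t Q, IsPathList R p t Q ∧ Q.length = n + 3 := by
  obtain ⟨i, j, hij, hijD⟩ : ∃ i j, i < j ∧ missEdges R B M x L q = {i, j} := by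
    obtain ⟨i, j, hne, he⟩ := Finset.card_eq_two.1 hcard
    rcases Nat.lt_or_gt_of_ne hne with hlt | hlt
    · exact ⟨i, j, hlt, he⟩
    · exact ⟨j, i, hlt, by rw [he, Finset.pair_comm]⟩
  have hi : i ∈ missEdges R B M x L q := by simp [hijD]
  have hj : j ∈ missEdges R B M x L q := by simp [hijD]
  have hi' := mem_missEdges.1 hi
  have hj' := mem_missEdges.1 hj
  have fi := (mem_freeEdges.1 hi'.1).1
  have fj := (mem_freeEdges.1 hj'.1).1
  have key : ∀ {u v}, u < M → v < M → Missing R B q (x u) → Missing R B q (x v) → u = v :=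
    fun hu hv m1 m2 => h.inj _ _ hu hv (h.miss _ _ _ m1 m2)
  obtain ⟨rfl, hm⟩ : j = i + 1 ∧ Missing R B q (x (i + 1)) := by
    rcases hi'.2 with m | m <;> rcases hj'.2 with m' | m'
    · have := key (by omega) (by omega) m m'; omega
    · have := key (by omega) (by omega) m m'; omega
    · exact ⟨(key (by omega) (by omega) m m').symm, m⟩
    · have := key (by omega) (by omega) m m'; omega
  rw [Finset.disjoint_left] at hdr hds
  exact h.exists_red_path_of_exclusive hq hr hs hqr hqs hrs hi'.1 hj'.1 hm (hdr hi) (hdr hj)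
    (hds hi) (hds hj) hE hQ

/-- Two disjoint alternating paths, one of which has distinct ends `a`, `b` without free common red
neighbour, can be linked and prolonged by three vertices if five edges are free. -/
lemma exists_red_path_of_not_closable (h : Config R B M x Y) (hW : IsAlternating R M x Y a b W)
    (hW' : IsAlternating R M x Y c d W') (hd : W.Disjoint W') (hab : a ≠ b)
    (nab : NoCommon R M x L a b)
    (hn : ∀ p q, p = a ∨ p = b → q = c ∨ q = d → NoCommon R M x L p q)
    (hE : 5 ≤ (freeEdges M x L).card) (hL : ∀ v, v ∈ W ∨ v ∈ W' → v ∈ L) :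
    ∃ p t Q, IsPathList R p t Q ∧ Q.length = W.length + W'.length + 3 := by
  have nblue : ∀ {p q}, p ∈ Y → q ∈ Y → NoCommon R M x L p q → ¬ B.Adj p q := by
    intro p q hp hq hpq hb
    have t1 := Finset.card_le_card (h.freeEdges_subset_of_blue hp hq hpq hb)
    have t2 := Finset.card_union_le (missEdges R B M x L p) (missEdges R B M x L q)
    have t3 := h.card_missEdges_le L p
    have t4 := h.card_missEdges_le L q
    omega
  have nac := hn a c (Or.inl rfl) (Or.inl rfl)
  have nbc := hn b c (Or.inr rfl) (Or.inl rfl)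
  have nad := hn a d (Or.inl rfl) (Or.inr rfl)
  have nbd := hn b d (Or.inr rfl) (Or.inr rfl)
  have hne : ∀ {p q}, p ∈ W → q ∈ W' → p ≠ q := fun hp hq e => hd hp (e ▸ hq)
  have hcard := hE.trans (Finset.card_le_card
    (h.freeEdges_subset_of_three hW.1 hW.2.1 hW'.1 nab nac nbc))
  have t1 := Finset.card_union_le (missEdges R B M x L a)
    (missEdges R B M x L b ∪ missEdges R B M x L c)
  have t2 := Finset.card_union_le (missEdges R B M x L b) (missEdges R B M x L c)
  have ta := h.card_missEdges_le L a
  have tb := h.card_missEdges_le L b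
  have tc := h.card_missEdges_le L c
  have rbc : R.Adj b c := by
    have := adj_or_missing (R := R) (B := B) (hne hW.2.2.right_mem hW'.2.2.left_mem)
    have := nblue hW.2.1 hW'.1 nbc
    have := h.not_missing_of_card (L := L) (a := b) (by omega) hW'.1
    tauto
  have rac : R.Adj a c := by
    have := adj_or_missing (R := R) (B := B) (hne hW.2.2.left_mem hW'.2.2.left_mem)
    have := nblue hW.1 hW'.1 nac
    have := h.not_missing_of_card (L := L) (a := a) (by omega) hW'.1
    tauto
  have rd : R.Adj a d ∨ R.Adj b d := by
    have := adj_or_missing (R := R) (B := B) (hne hW.2.2.left_mem hW'.2.2.right_mem)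
    have := adj_or_missing (R := R) (B := B) (hne hW.2.2.right_mem hW'.2.2.right_mem)
    have := nblue hW.1 hW'.2.1 nad
    have := nblue hW.2.1 hW'.2.1 nbd
    by_contra! hcon
    exact hab (h.miss_left (a := a) (b := b) (c := d) (by tauto) (by tauto))
  have hQ : ∀ p, p = a ∨ p = b ∨ p = c → ∃ t ∈ Y, ∃ Q, NoCommon R M x L p t ∧
      IsPathList R p t Q ∧ Q.length = W.length + W'.length ∧ ∀ v ∈ Q, v ∈ L := by
    rintro p (rfl | rfl | rfl)
    · exact ⟨d, hW'.2.1, _, nad, hW.red.append hW'.red rbc hd, by simp, by simpa using hL⟩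
    · exact ⟨d, hW'.2.1, _, nbd, hW.reverse.red.append hW'.red rac (by simpa using hd), by simp,
        by simpa using hL⟩
    · rcases rd with rd | rd
      · exact ⟨b, hW.2.1, _, nbc.symm, hW'.red.append hW.red rd.symm hd.symm,
          by simp [add_comm], fun v hv => hL v (by simpa using (List.mem_append.1 hv).symm)⟩
      · exact ⟨a, hW.1, _, nac.symm, hW'.red.append hW.reverse.red rd.symm
          (by simpa using hd.symm), by simp [add_comm],
          fun v hv => hL v (by simpa [or_comm] using hv)⟩
  rcases exists_exclusive ta tb tc hcard with ⟨e1, e2, e3⟩ | ⟨e1, e2, e3⟩ | ⟨e1, e2, e3⟩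
  · exact h.exists_red_path_of_card_two hW.1 hW.2.1 hW'.1 nab nac nbc e1 e2 e3 hE
      fun p hp => hQ p (by tauto)
  · exact h.exists_red_path_of_card_two hW.2.1 hW.1 hW'.1 nab.symm nbc nac e1 e2 e3 hE
      fun p hp => hQ p (by tauto)
  · exact h.exists_red_path_of_card_two hW'.1 hW.1 hW.2.1 nac.symm nbc.symm nab e1 e2 e3 hE
      fun p hp => hQ p (by tauto)

end Config

namespace LongestPair

lemma card_of_cover (P : LongestPair R M x Y a b c d W W') (h : Config R B M x Y)
    (hcov : ∀ y ∈ Y, y ∈ W ++ W') :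
    (usedIdx M x (W ++ W')).card + 2 = Y.card ∧ W.length + W'.length + 2 = 2 * Y.card := by
  have h1 := P.alt.card_used h
  have h2 := P.alt.length_eq h
  have h3 := P.alt'.card_used h
  have h4 := P.alt'.length_eq h
  have h5 := card_filter_mem_append (Y := Y) P.disj
  have h6 := card_usedIdx_append (M := M) (x := x) P.disj
  rw [Finset.filter_true_of_mem hcov] at h5
  omega

/-- If a vertex of the blue path on `W` is red to an end of `W'`, the path `W` does not close to a
cycle through a free vertex: this cycle could be linked to `W'`. -/
lemma not_closable_of_mem (P : LongestPair R M x Y a b c d W W') (h : Config R B M x Y)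
    (hj : j < M) (hjW : x j ∈ W) {q : V} (hq : q = c ∨ q = d) (hqj : R.Adj q (x j)) :
    NoCommon R M x (W ++ W') a b := by
  intro i hi hiL ha hb
  rw [List.mem_append, not_or] at hiL
  rcases hq with rfl | rfl
  · obtain ⟨u, N, hN, hlen⟩ := P.alt.exists_longer h P.alt' P.disj hi hiL.1 hiL.2 ha hb hj hjW hqj
    have := P.le _ _ _ hN
    omega
  · obtain ⟨u, N, hN, hlen⟩ := P.alt.exists_longer h P.alt'.reverse (by simpa using P.disj) hi
      hiL.1 (by simpa using hiL.2) ha hb hj hjW hqj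
    have := P.le _ _ _ hN
    rw [List.length_reverse] at hlen
    omega

lemma not_closable_of_mem' (P : LongestPair R M x Y a b c d W W') (h : Config R B M x Y)
    (hj : j < M) (hjW : x j ∈ W') {q : V} (hq : q = a ∨ q = b) (hqj : R.Adj q (x j)) :
    NoCommon R M x (W ++ W') c d := by
  intro i hi hiL ha hb
  rw [List.mem_append, not_or] at hiL
  rcases hq with rfl | rfl
  · obtain ⟨u, N, hN, hlen⟩ := P.alt'.exists_longer h P.alt P.disj.symm hi hiL.2 hiL.1 ha hb hj
      hjW hqj
    have := P.le _ _ _ hN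
    omega
  · obtain ⟨u, N, hN, hlen⟩ := P.alt'.exists_longer h P.alt.reverse (by simpa using P.disj.symm) hi
      hiL.2 (by simpa using hiL.1) ha hb hj hjW hqj
    have := P.le _ _ _ hN
    rw [List.length_reverse] at hlen
    omega

lemma path_reverse (P : LongestPair R M x Y a b c d W W') :
    LongestPair R M (fun i => x (M - 1 - i)) Y a b c d W W' where
  alt := isAlternating_reverse.2 P.alt
  alt' := isAlternating_reverse.2 P.alt'
  disj := P.disj
  le p q L hL := P.le p q L (isAlternating_reverse.1 hL)
  le' p q L hL := P.le' p q L (isAlternating_reverse.1 hL)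

/-- If `x 0` is not used, it is missed by the only vertex `c` of `W'` and closes `W` to a cycle. As
`c` does not miss the other end of the path, this cycle can be linked to `c`. -/
lemma first_mem (P : LongestPair R M x Y a b c d W W') (h : Config R B M x Y) (hM : 2 ≤ M)
    (hW : 1 < W.length) : x 0 ∈ W ++ W' := by
  by_contra h0
  have hab := P.alt.ends_ne hW
  have hne : x 0 ≠ x (M - 1) := fun e => by
    have := h.inj _ _ h.pos (by omega) e
    omega
  have hn : ∀ p q, p = a ∨ p = b → q = c ∨ q = d → R.Adj p (x 0) → ¬ R.Adj q (x 0) :=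
    fun p q hp hq => P.noCommon hp hq 0 h.pos h0
  have ra := h.red_first P.alt.1
  have rb := h.red_first P.alt.2.1
  have rc := h.red_first P.alt'.1
  have rd := h.red_first P.alt'.2.1
  obtain ⟨p, hp, hp0⟩ : ∃ p, (p = a ∨ p = b) ∧ R.Adj p (x 0) := by
    by_cases ma : Missing R B a (x 0)
    · exact ⟨b, Or.inr rfl, rb fun m => hab (h.miss_left ma m)⟩
    · exact ⟨a, Or.inl rfl, ra ma⟩
  have mc := not_not.1 (mt rc (hn p c hp (Or.inl rfl) hp0))
  have md := not_not.1 (mt rd (hn p d hp (Or.inr rfl) hp0))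
  obtain rfl : c = d := h.miss_left mc md
  have hcW : ∀ {p}, p ∈ W → p ≠ c := fun hp e => P.disj hp (e ▸ P.alt'.2.2.left_mem)
  have ra' := ra fun m => hcW P.alt.2.2.left_mem (h.miss_left m mc)
  have rb' := rb fun m => hcW P.alt.2.2.right_mem (h.miss_left m mc)
  have rcl : R.Adj c (x (M - 1)) := h.red_last P.alt'.1 fun m => hne (h.miss _ _ _ mc m)
  have hl : x (M - 1) ∈ W := by
    by_contra hl
    have hl' : x (M - 1) ∉ W ++ W' := by
      rw [List.mem_append, not_or, P.alt'.2.2.eq_singleton, List.mem_singleton]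
      exact ⟨hl, h.ne_of_mem P.alt'.1 _ (by omega)⟩
    have na : ¬ R.Adj a (x (M - 1)) := fun hr =>
      P.noCommon (Or.inl rfl) (Or.inl rfl) _ (by omega) hl' hr rcl
    have nb : ¬ R.Adj b (x (M - 1)) := fun hr =>
      P.noCommon (Or.inr rfl) (Or.inl rfl) _ (by omega) hl' hr rcl
    exact hab (h.miss_left (not_not.1 (mt (h.red_last P.alt.1) na))
      (not_not.1 (mt (h.red_last P.alt.2.1) nb)))
  exact P.not_closable_of_mem h (by omega) hl (Or.inl rfl) rcl 0 h.pos h0 ra' rb'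

lemma last_mem (P : LongestPair R M x Y a b c d W W') (h : Config R B M x Y) (hM : 2 ≤ M)
    (hW : 1 < W.length) : x (M - 1) ∈ W ++ W' := by
  simpa using P.path_reverse.first_mem h.reverse hM hW

lemma exists_red_path_of_red_even (P : LongestPair R M x Y a b c d W W') (h : Config R B M x Y)
    (hE : 4 ≤ (freeEdges M x (W ++ W')).card) (hbc : R.Adj b c) :
    ∃ p q L, IsPathList R p q L ∧ L.length = W.length + W'.length + 2 := by
  obtain ⟨i, hi, hiL, hai⟩ := h.exists_red (L := W ++ W') P.alt.1 (by omega)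
  obtain ⟨j, hj, hjL, hdj⟩ := h.exists_red (L := W ++ W') P.alt'.2.1 (by omega)
  have hne : x j ≠ x i := fun e => by
    rw [e] at hdj
    exact P.noCommon (Or.inl rfl) (Or.inr rfl) i hi hiL hai hdj
  refine ⟨_, _, _, ((P.alt.red.append P.alt'.red hbc P.disj).cons hai.symm hiL).concat hdj ?_,
    by simp; omega⟩
  rw [List.mem_cons, not_or]
  exact ⟨hne, hjL⟩

/-- Some end of `W` is red to the end `c` of `W'`: a blue edge between the ends of `W` and `W'`
confines the free edges to those that contain a vertex missed by one of its ends. -/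
lemma exists_red_path_even (P : LongestPair R M x Y a b c d W W') (h : Config R B M x Y)
    (hcov : ∀ y ∈ Y, y ∈ W ++ W') (hk : 3 ≤ Y.card) (hM : 2 * Y.card ≤ M + 1) :
    ∃ p q L, IsPathList R p q L ∧ 2 * Y.card ≤ L.length := by
  obtain ⟨hu, hlen⟩ := P.card_of_cover h hcov
  have hle := P.length_le
  have hab := P.alt.ends_ne (by omega)
  have hE := le_card_freeEdges (by omega) (P.first_mem h (by omega) (by omega))
    (P.last_mem h (by omega) (by omega))
  by_cases hbc : R.Adj b c
  · obtain ⟨p, q, L, hL, hl⟩ := P.exists_red_path_of_red_even h (by omega) hbc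
    exact ⟨p, q, L, hL, by omega⟩
  by_cases hac : R.Adj a c
  · obtain ⟨p, q, L, hL, hl⟩ := P.reverse_left.exists_red_path_of_red_even h (by
      rw [show freeEdges M x (W.reverse ++ W') = freeEdges M x (W ++ W') by
        ext; simp [mem_freeEdges]]
      omega) hac
    rw [List.length_reverse] at hl
    exact ⟨p, q, L, hL, by omega⟩
  exfalso
  have hne : ∀ {p}, p ∈ W → p ≠ c := fun hp e => P.disj hp (e ▸ P.alt'.2.2.left_mem)
  have ca := adj_or_missing (R := R) (B := B) (hne P.alt.2.2.left_mem)
  have cb := adj_or_missing (R := R) (B := B) (hne P.alt.2.2.right_mem)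
  have sa := h.freeEdges_subset_of_blue P.alt.1 P.alt'.1 (P.noCommon (Or.inl rfl) (Or.inl rfl))
  have sb := h.freeEdges_subset_of_blue P.alt.2.1 P.alt'.1 (P.noCommon (Or.inr rfl) (Or.inl rfl))
  have ta := h.card_missEdges_le (W ++ W') a
  have tb := h.card_missEdges_le (W ++ W') b
  have tc := h.card_missEdges_le (W ++ W') c
  have ua := Finset.card_union_le (missEdges R B M x (W ++ W') a) (missEdges R B M x (W ++ W') c)
  have ub := Finset.card_union_le (missEdges R B M x (W ++ W') b) (missEdges R B M x (W ++ W') c)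
  have hc0 : ∀ {p}, p ∈ Y → Missing R B p c → (missEdges R B M x (W ++ W') c).card = 0 := by
    intro p hp hm
    by_contra hc
    exact h.not_missing_of_card (Nat.pos_of_ne_zero hc) hp hm.symm
  rcases ca.resolve_left hac with ba | ma <;> rcases cb.resolve_left hbc with bb | mb
  · have hs : freeEdges M x (W ++ W') ⊆
        (missEdges R B M x (W ++ W') a ∩ missEdges R B M x (W ++ W') b) ∪
          missEdges R B M x (W ++ W') c := by
      rw [Finset.inter_union_distrib_right]
      exact Finset.subset_inter (sa ba) (sb bb)
    have := Finset.card_le_card hs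
    have := Finset.card_union_le
      (missEdges R B M x (W ++ W') a ∩ missEdges R B M x (W ++ W') b)
      (missEdges R B M x (W ++ W') c)
    have := h.card_missEdges_inter_le (W ++ W') hab
    omega
  · have := Finset.card_le_card (sa ba)
    have := hc0 P.alt.2.1 mb
    omega
  · have := Finset.card_le_card (sb bb)
    have := hc0 P.alt.1 ma
    omega
  · exact hab (h.miss_left ma mb)

/-- The ends of the blue path are used, and the edges at them show that one of `W` and `W'` has
distinct ends and does not close to a cycle. -/
lemma exists_red_path_odd (P : LongestPair R M x Y a b c d W W') (h : Config R B M x Y)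
    (hcov : ∀ y ∈ Y, y ∈ W ++ W') (hk : 3 ≤ Y.card) (hM : 2 * Y.card ≤ M) :
    ∃ p q L, IsPathList R p q L ∧ 2 * Y.card + 1 ≤ L.length := by
  obtain ⟨hu, hlen⟩ := P.card_of_cover h hcov
  have hle := P.length_le
  have hab := P.alt.ends_ne (by omega)
  have h0 := P.first_mem h (by omega) (by omega)
  have h1 := P.last_mem h (by omega) (by omega)
  have hE := le_card_freeEdges (by omega) h0 h1
  have hne : x 0 ≠ x (M - 1) := fun e => by
    have := h.inj _ _ h.pos (by omega) e
    omega
  suffices ∃ p q L, IsPathList R p q L ∧ L.length = W.length + W'.length + 3 by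
    obtain ⟨p, q, L, hL, hl⟩ := this
    exact ⟨p, q, L, hL, by omega⟩
  have caseW : NoCommon R M x (W ++ W') a b →
      ∃ p q L, IsPathList R p q L ∧ L.length = W.length + W'.length + 3 := fun nab =>
    h.exists_red_path_of_not_closable P.alt P.alt' P.disj hab nab (fun p q => P.noCommon)
      (by omega) (by simp)
  have caseW' : c ≠ d → NoCommon R M x (W ++ W') c d →
      ∃ p q L, IsPathList R p q L ∧ L.length = W.length + W'.length + 3 := by
    intro hcd ncd
    obtain ⟨p, q, L, hL, hl⟩ := h.exists_red_path_of_not_closable P.alt' P.alt P.disj.symm hcd ncd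
      (fun p q hp hq => (P.noCommon hq hp).symm) (by omega) (by simp [or_comm])
    exact ⟨p, q, L, hL, by omega⟩
  by_cases hcd : c = d
  · subst hcd
    have hW' := P.alt'.2.2.eq_singleton
    have hmem : ∀ j < M, x j ∈ W ++ W' → x j ∈ W := by
      intro j hj hjW
      rw [List.mem_append, hW', List.mem_singleton] at hjW
      exact hjW.resolve_right (h.ne_of_mem P.alt'.1 j hj)
    by_cases m : Missing R B c (x 0)
    · exact caseW (P.not_closable_of_mem h (by omega) (hmem _ (by omega) h1) (Or.inl rfl)
        (h.red_last P.alt'.1 fun m' => hne (h.miss _ _ _ m m')))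
    · exact caseW (P.not_closable_of_mem h h.pos (hmem _ h.pos h0) (Or.inl rfl)
        (h.red_first P.alt'.1 m))
  · rcases List.mem_append.1 h0 with h0 | h0
    · by_cases m : Missing R B c (x 0)
      · exact caseW (P.not_closable_of_mem h h.pos h0 (Or.inr rfl)
          (h.red_first P.alt'.2.1 fun m' => hcd (h.miss_left m m')))
      · exact caseW (P.not_closable_of_mem h h.pos h0 (Or.inl rfl) (h.red_first P.alt'.1 m))
    · by_cases m : Missing R B a (x 0)
      · exact caseW' hcd (P.not_closable_of_mem' h h.pos h0 (Or.inr rfl)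
          (h.red_first P.alt.2.1 fun m' => hab (h.miss_left m m')))
      · exact caseW' hcd (P.not_closable_of_mem' h h.pos h0 (Or.inl rfl) (h.red_first P.alt.1 m))

end LongestPair

end TwoPaths

/-! ### The upper bound -/

section Upper

open scoped Classical

variable {V : Type*} {R B : SimpleGraph V} {M n m : ℕ} {x : ℕ → V} {Y : Finset V}

/-- The graph `G` contains a path on `n` vertices (for positive `n`). -/
def HasPath (G : SimpleGraph V) (n : ℕ) : Prop :=
  ∃ a b L, IsPathList G a b L ∧ n ≤ L.length

lemma HasPath.two {G : SimpleGraph V} {a b : V} (h : G.Adj a b) : HasPath G 2 :=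
  ⟨_, _, _, (IsPathList.singleton G b).cons h (by simpa using h.ne), by simp⟩

lemma HasPath.three {G : SimpleGraph V} {a b c : V} (hab : G.Adj a b) (hbc : G.Adj b c)
    (hac : a ≠ c) : HasPath G 3 :=
  ⟨_, _, _, ((IsPathList.singleton G c).cons hbc (by simpa using hbc.ne)).cons hab
    (by simpa using ⟨hab.ne, hac⟩), by simp⟩

lemma HasPath.exists_three {G : SimpleGraph V} (h : HasPath G 3) :
    ∃ a b c, G.Adj a b ∧ G.Adj b c ∧ a ≠ c := by
  obtain ⟨a, b, L, ⟨h1, h2, -, -⟩, hl⟩ := h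
  match L, h1, h2, hl with
  | u :: v :: w :: L, h1, h2, _ =>
    rw [List.isChain_cons_cons, List.isChain_cons_cons] at h1
    refine ⟨u, v, w, h1.1, h1.2.1, ?_⟩
    rintro rfl
    simp at h2

/-- If the ends of a longest path are adjacent, all its vertices lie on a cycle, which can be opened
between its first two vertices. -/
lemma IsLongestPath.rotate (h : IsLongestPath B M x) (hb : B.Adj (x (M - 1)) (x 0)) :
    IsLongestPath B M (fun i => if i + 1 < M then x (i + 1) else x 0) where
  pos := h.pos
  inj i j hi hj hij := by
    split_ifs at hij with h1 h2 h2
    · have := h.inj _ _ h1 h2 hij; omega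
    · have := h.inj _ _ h1 h.pos hij; omega
    · have := h.inj _ _ h.pos h2 hij; omega
    · omega
  chain i hi := by
    rw [if_pos hi]
    split_ifs with h2
    · exact h.chain _ h2
    · rwa [show i + 1 = M - 1 by omega]
  le := h.le

namespace Config

/-- Two vertices of `Y` without common red neighbour on the whole path, one of which misses `x 0`:
the other one misses the other end of the path, and these two ends are joined by a red edge. -/
lemma exists_red_path_of_missing {a c : V} (h : Config R B M x Y) (ha : a ∈ Y) (hc : c ∈ Y)
    (hac : a ≠ c) (hn : ∀ i < M, R.Adj a (x i) → ¬ R.Adj c (x i)) (hM : 3 ≤ M)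
    (mc : Missing R B c (x 0)) : HasPath R 4 ∧ (4 ≤ M → HasPath R 5) := by
  have hne : ∀ i j, i < M → j < M → i ≠ j → x i ≠ x j :=
    fun i j hi hj hij e => hij (h.inj _ _ hi hj e)
  have hcl := h.red_last hc fun m => hne 0 (M - 1) (by omega) (by omega) (by omega)
    (h.miss _ _ _ mc m)
  have ma := not_not.1 (mt (h.red_last ha) fun hr => hn _ (by omega) hr hcl)
  have ha0 := h.red_first ha fun m => hac (h.miss_left m mc)
  have missa : ∀ i, i + 1 < M → ¬ Missing R B a (x i) := fun i hi m =>
    hne i (M - 1) (by omega) (by omega) (by omega) (h.miss _ _ _ m ma)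
  have n0a := h.ne_of_mem ha 0 h.pos
  have nla := h.ne_of_mem ha (M - 1) (by omega)
  have n0c := h.ne_of_mem hc 0 h.pos
  have nlc := h.ne_of_mem hc (M - 1) (by omega)
  have n0l := hne 0 (M - 1) (by omega) (by omega) (by omega)
  rcases adj_or_missing (R := R) (B := B) n0l with hr | hb | m
  · have hp : IsPathList R a c [a, x 0, x (M - 1), c] := by
      refine ⟨?_, ?_, rfl, rfl⟩
      · simp [ha0, hr, hcl.symm]
      · simp [hac, n0a.symm, nla.symm, n0l, n0c, nlc]
    refine ⟨⟨_, _, _, hp, by simp⟩, fun hM4 => ?_⟩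
    have key : ∀ i, i + 1 < M → i ≠ 0 → R.Adj a (x i) → HasPath R 5 := by
      intro i hi hi0 hai
      refine ⟨_, _, _, hp.cons hai.symm ?_, by simp⟩
      simp only [List.mem_cons, List.not_mem_nil, or_false, not_or]
      exact ⟨h.ne_of_mem ha i (by omega), hne _ _ (by omega) (by omega) hi0,
        hne _ _ (by omega) (by omega) (by omega), h.ne_of_mem hc i (by omega)⟩
    rcases h.red_or_red ha (i := 1) (by omega) (missa 1 (by omega)) (missa 2 (by omega))
      with h' | h'
    · exact key 1 (by omega) (by omega) h'
    · exact key 2 (by omega) (by omega) h'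
  · exfalso
    have hrot := h.toIsLongestPath.rotate hb.symm
    have nb : ∀ {y}, y ∈ Y → ¬ B.Adj y (x 1) := by
      intro y hy
      have := hrot.not_adj_first (v := y) (by
        intro i hi
        split_ifs with h1
        · exact h.ne_of_mem hy _ h1
        · exact h.ne_of_mem hy _ h.pos)
      rwa [if_pos (by omega)] at this
    have r1 := adj_or_missing (R := R) (B := B) (h.ne_of_mem ha 1 (by omega)).symm
    have r2 := adj_or_missing (R := R) (B := B) (h.ne_of_mem hc 1 (by omega)).symm
    have m1 := missa 1 (by omega)
    have m2 : ¬ Missing R B c (x 1) := fun m =>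
      hne 1 0 (by omega) (by omega) (by omega) (h.miss _ _ _ m mc)
    have b1 := nb ha
    have b2 := nb hc
    have := hn 1 (by omega)
    tauto
  · exact absurd (h.miss _ _ _ m mc.symm) nlc

lemma exists_red_path_of_two {a c : V} (h : Config R B M x Y) (ha : a ∈ Y) (hc : c ∈ Y)
    (hac : a ≠ c) (hn : ∀ i < M, R.Adj a (x i) → ¬ R.Adj c (x i)) (hM : 3 ≤ M) :
    HasPath R 4 ∧ (4 ≤ M → HasPath R 5) := by
  by_cases mc : Missing R B c (x 0)
  · exact h.exists_red_path_of_missing ha hc hac hn hM mc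
  · have ma := not_not.1 (mt (h.red_first ha) fun hr => hn 0 h.pos hr (h.red_first hc mc))
    exact h.exists_red_path_of_missing hc ha hac.symm (fun i hi h1 h2 => hn i hi h2 h1) hM ma

/-- Either one alternating path covers `Y` or two greedily chosen ones do; in both cases they
yield the red path. -/
lemma exists_red_path [Fintype V] (h : Config R B M x Y) (hk : 2 ≤ Y.card) :
    (2 * Y.card ≤ M + 1 → HasPath R (2 * Y.card)) ∧
      (2 * Y.card ≤ M → HasPath R (2 * Y.card + 1)) := by
  obtain ⟨y₀, hy₀⟩ : Y.Nonempty := Finset.card_pos.1 (by omega)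
  obtain ⟨W, ⟨a, b, hW⟩, hmax⟩ := exists_longest_list
    (fun L => ∃ a b, IsAlternating R M x Y a b L) (fun L ⟨_, _, hL⟩ => hL.2.2.nodup)
    ⟨_, _, _, IsAlternating.singleton R M x hy₀⟩
  by_cases hcov : ∀ y ∈ Y, y ∈ W
  · exact ⟨hW.exists_red_path_even h hcov hk, hW.exists_red_path_odd h hcov hk⟩
  push Not at hcov
  obtain ⟨y₁, hy₁, hy₁W⟩ := hcov
  obtain ⟨W', ⟨⟨c, d, hW'⟩, hd⟩, hmax'⟩ := exists_longest_list
    (fun L => (∃ a b, IsAlternating R M x Y a b L) ∧ W.Disjoint L)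
    (fun L ⟨⟨_, _, hL⟩, _⟩ => hL.2.2.nodup)
    ⟨_, ⟨_, _, IsAlternating.singleton R M x hy₁⟩, by simpa using hy₁W⟩
  have P : LongestPair R M x Y a b c d W W' :=
    ⟨hW, hW', hd, fun p q L hL => hmax L ⟨p, q, hL⟩, fun p q L hL hL' => hmax' L ⟨⟨p, q, hL⟩, hL'⟩⟩
  by_cases hM : 2 * Y.card ≤ M + 1
  swap
  · exact ⟨fun h' => absurd h' hM, fun h' => absurd h' (by omega)⟩
  have hcov := fun y hy => P.cover (y := y) h hM (by omega) hy
  rcases Nat.lt_or_ge Y.card 3 with hk3 | hk3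
  · obtain ⟨hu, -⟩ := P.card_of_cover h hcov
    have hu0 : (usedIdx M x (W ++ W')).card = 0 := by omega
    rw [Finset.card_eq_zero, usedIdx, Finset.filter_eq_empty_iff] at hu0
    have key := h.exists_red_path_of_two hW.2.1 hW'.1
      (fun e => hd hW.2.2.right_mem (e ▸ hW'.2.2.left_mem))
      (fun i hi => P.noCommon (Or.inr rfl) (Or.inl rfl) i hi (hu0 (by simpa using hi)))
      (by omega)
    rw [show Y.card = 2 by omega]
    exact ⟨fun _ => key.1, fun hM4 => key.2 (by omega)⟩
  · exact ⟨fun _ => P.exists_red_path_even h hcov hk3 hM, P.exists_red_path_odd h hcov hk3⟩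

end Config

lemma exists_isLongestPath (hm : 0 < m) (h1 : HasPath B m) (h2 : ¬ HasPath B (m + 1)) :
    ∃ x, IsLongestPath B m x := by
  obtain ⟨a, b, L, hL, hml⟩ := h1
  have hle : ∀ p q K, IsPathList B p q K → K.length ≤ m := fun p q K hK => by
    by_contra hcon
    exact h2 ⟨p, q, K, hK, by omega⟩
  have hlen : L.length = m := le_antisymm (hle _ _ _ hL) hml
  have hget : ∀ i (hi : i < L.length), L.getD i a = L[i] := fun i hi =>
    List.getD_eq_getElem _ _ hi
  refine ⟨fun i => L.getD i a, hm, ?_, ?_, hle⟩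
  · intro i j hi hj hij
    rw [hget i (by omega), hget j (by omega)] at hij
    exact (hL.nodup.getElem_inj_iff).1 hij
  · intro i hi
    rw [hget i (by omega), hget (i + 1) (by omega)]
    exact List.isChain_iff_getElem.1 hL.1 i (by omega)

lemma exists_config [Fintype V] (hmiss : ∀ a b c, Missing R B a b → Missing R B a c → b = c)
    {k : ℕ} (hm : 0 < m) (h1 : HasPath B m) (h2 : ¬ HasPath B (m + 1))
    (hcard : m + k ≤ Fintype.card V) : ∃ x Y, Config R B m x Y ∧ Y.card = k := by
  obtain ⟨x, hx⟩ := exists_isLongestPath hm h1 h2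
  have hc : k ≤ ((Finset.range m).image x)ᶜ.card := by
    rw [Finset.card_compl]
    have := Finset.card_image_le (s := Finset.range m) (f := x)
    rw [Finset.card_range] at this
    omega
  obtain ⟨Y, hY, hYk⟩ := Finset.exists_subset_card_eq hc
  refine ⟨x, Y, ⟨hx, hmiss, fun i hi hiY => ?_⟩, hYk⟩
  have := hY hiY
  rw [Finset.mem_compl, Finset.mem_image] at this
  exact this ⟨i, by simpa using hi, rfl⟩

/-- The induction step: a blue path on one vertex too few gives a longer one or the red path. -/
lemma hasPath_step [Fintype V] (hmiss : ∀ a b c, Missing R B a b → Missing R B a c → b = c)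
    (hn : 2 ≤ n) (hnm : n ≤ m) (h22 : n = 2 → 3 ≤ m) (h33 : n = 3 → 5 ≤ m)
    (hcard : m + n / 2 - 1 ≤ Fintype.card V) (hB : HasPath B (m - 1)) :
    HasPath R n ∨ HasPath B m := by
  by_contra hcon
  rw [not_or] at hcon
  obtain ⟨hR, hBm⟩ := hcon
  obtain ⟨x, Y, h, hY⟩ := exists_config (k := n / 2) hmiss (by omega) hB
    (by rwa [Nat.sub_add_cancel (by omega)]) (by omega)
  rcases Nat.lt_or_ge n 4 with hn4 | hn4
  · obtain ⟨y, hy⟩ : Y.Nonempty := Finset.card_pos.1 (by omega)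
    have hne : ∀ i j, i < m - 1 → j < m - 1 → i ≠ j → x i ≠ x j :=
      fun i j hi hj hij e => hij (h.inj _ _ hi hj e)
    obtain rfl | rfl : n = 2 ∨ n = 3 := by omega
    · have m0 := not_not.1 (mt (h.red_first hy) fun hr => hR (HasPath.two hr))
      have m1 := not_not.1 (mt (h.red_last hy) fun hr => hR (HasPath.two hr))
      exact hne 0 (m - 1 - 1) (by omega) (by omega) (by omega) (h.miss _ _ _ m0 m1)
    · -- Both ends of the blue path are red to `y` or missed by it, so `y` is blue to the others.
      have hR' : ∀ {i j}, i < m - 1 → j < m - 1 → i ≠ j → R.Adj y (x i) → ¬ R.Adj y (x j) :=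
        fun hi hj hij h1 h2 => hR (HasPath.three h1.symm h2 (hne _ _ hi hj hij))
      have hM' : ∀ {i j}, i < m - 1 → j < m - 1 → i ≠ j → Missing R B y (x i) →
          ¬ Missing R B y (x j) :=
        fun hi hj hij h1 h2 => hne _ _ hi hj hij (h.miss _ _ _ h1 h2)
      have r0 := h.red_first hy
      have rl := h.red_last hy
      have key : ∀ i, 0 < i → i < m - 1 - 1 → B.Adj y (x i) := by
        intro i hi0 hi
        rcases adj_or_missing (R := R) (B := B) (h.ne_of_mem hy i (by omega)).symm with hr | hb | hm
        · have m0 := not_not.1 (mt r0 (hR' (i := i) (by omega) (by omega) (by omega) hr))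
          have ml := not_not.1 (mt rl (hR' (i := i) (by omega) (by omega) (by omega) hr))
          exact absurd ml (hM' (by omega) (by omega) (by omega) m0)
        · exact hb
        · have e0 := r0 (hM' (i := i) (by omega) (by omega) (by omega) hm)
          have el := rl (hM' (i := i) (by omega) (by omega) (by omega) hm)
          exact absurd el (hR' (by omega) (by omega) (by omega) e0)
      exact h.not_adj_consecutive (h.ne_of_mem hy) (i := 1) (by omega) (key 1 (by omega) (by omega))
        (key 2 (by omega) (by omega))
  · have key := h.exists_red_path (by omega)
    rw [hY] at key
    rcases Nat.even_or_odd' n with ⟨k, rfl | rfl⟩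
    · rw [show 2 * k / 2 = k by omega] at key
      exact hR (key.1 (by omega))
    · rw [show (2 * k + 1) / 2 = k by omega] at key
      exact hR (key.2 (by omega))

/-- Two red, two blue or two missing pairs meet at any given one of at least five vertices. -/
lemma hasPath_three_or_three [Fintype V]
    (hmiss : ∀ a b c, Missing R B a b → Missing R B a c → b = c) (hcard : 5 ≤ Fintype.card V) :
    HasPath R 3 ∨ HasPath B 3 := by
  by_contra! hcon
  obtain ⟨v⟩ : Nonempty V := Fintype.card_pos_iff.1 (by omega)
  have hsub : Finset.univ.erase v ⊆ Finset.univ.filter (R.Adj v) ∪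
      (Finset.univ.filter (B.Adj v) ∪ Finset.univ.filter (Missing R B v)) := by
    intro u hu
    have := adj_or_missing (R := R) (B := B) (Finset.ne_of_mem_erase hu).symm
    simpa using this
  have hle := Finset.card_le_card hsub
  rw [Finset.card_erase_of_mem (Finset.mem_univ v), Finset.card_univ] at hle
  have t1 := Finset.card_union_le (Finset.univ.filter (R.Adj v))
    (Finset.univ.filter (B.Adj v) ∪ Finset.univ.filter (Missing R B v))
  have t2 := Finset.card_union_le (Finset.univ.filter (B.Adj v))
    (Finset.univ.filter (Missing R B v))
  have s1 : (Finset.univ.filter (R.Adj v)).card ≤ 1 := Finset.card_le_one.2 fun a ha b hb => by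
    by_contra hab
    exact hcon.1 (HasPath.three (Finset.mem_filter.1 ha).2.symm (Finset.mem_filter.1 hb).2 hab)
  have s2 : (Finset.univ.filter (B.Adj v)).card ≤ 1 := Finset.card_le_one.2 fun a ha b hb => by
    by_contra hab
    exact hcon.2 (HasPath.three (Finset.mem_filter.1 ha).2.symm (Finset.mem_filter.1 hb).2 hab)
  have s3 : (Finset.univ.filter (Missing R B v)).card ≤ 1 :=
    Finset.card_le_one.2 fun a ha b hb =>
      hmiss _ _ _ (Finset.mem_filter.1 ha).2 (Finset.mem_filter.1 hb).2
  omega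

lemma hasPath_three_or_four [Fintype V]
    (hmiss : ∀ a b c, Missing R B a b → Missing R B a c → b = c) (hcard : 5 ≤ Fintype.card V) :
    HasPath R 3 ∨ HasPath B 4 := by
  by_contra! hcon
  have hR : ∀ {a b c}, R.Adj a b → R.Adj a c → b = c := fun h1 h2 => by
    by_contra hne
    exact hcon.1 (HasPath.three h1.symm h2 hne)
  obtain ⟨x, Y, h, hY⟩ := exists_config (k := 2) hmiss (by omega)
    ((hasPath_three_or_three hmiss hcard).resolve_left hcon.1) hcon.2 hcard
  obtain ⟨y, z, hyz, rfl⟩ := Finset.card_eq_two.1 hY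
  have hne : ∀ i j, i < 3 → j < 3 → i ≠ j → x i ≠ x j :=
    fun i j hi hj hij e => hij (h.inj _ _ hi hj e)
  -- One of `x 0` and `x 2` is red to `v`, and `v` misses the other one.
  have key : ∀ v ∈ ({y, z} : Finset V), ∀ u, u ≠ x 0 → u ≠ x 2 → u ≠ v → B.Adj v u := by
    intro v hv u h0 h2 huv
    have r0 := h.red_first hv
    have r2 := h.red_last hv
    rcases adj_or_missing (R := R) (B := B) huv.symm with hr | hb | hm
    · have m0 := not_not.1 (mt r0 fun hr' => h0 (hR hr hr'))
      have m2 := not_not.1 (mt r2 fun hr' => h2 (hR hr hr'))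
      exact absurd (h.miss _ _ _ m0 m2) (hne 0 2 (by omega) (by omega) (by omega))
    · exact hb
    · have e0 := r0 fun hm' => h0 (h.miss _ _ _ hm hm')
      have e2 := r2 fun hm' => h2 (h.miss _ _ _ hm hm')
      exact absurd (hR e0 e2) (hne 0 2 (by omega) (by omega) (by omega))
  have hy : y ∈ ({y, z} : Finset V) := by simp
  have hz : z ∈ ({y, z} : Finset V) := by simp
  have b1 := key y hy z (h.ne_of_mem hz 0 (by omega)).symm (h.ne_of_mem hz 2 (by omega)).symm
    hyz.symm
  have b2 := key z hz (x 1) (hne 1 0 (by omega) (by omega) (by omega))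
    (hne 1 2 (by omega) (by omega) (by omega)) (h.ne_of_mem hz 1 (by omega))
  have b3 := h.chain 0 (by omega)
  refine hcon.2 ⟨y, x 0, [y, z, x 1, x 0], ⟨?_, ?_, rfl, rfl⟩, by simp⟩
  · simp [b1, b2, b3.symm]
  · simp [hyz, (h.ne_of_mem hy 1 (by omega)).symm, (h.ne_of_mem hy 0 (by omega)).symm,
      (h.ne_of_mem hz 1 (by omega)).symm, (h.ne_of_mem hz 0 (by omega)).symm,
      hne 1 0 (by omega) (by omega) (by omega)]

/-- The upper bound, for graphs that are complete up to a matching. -/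
theorem hasPath_or_hasPath [Fintype V] (s : ℕ) : ∀ (R B : SimpleGraph V) (n m : ℕ), n + m = s →
    (∀ a b c, Missing R B a b → Missing R B a c → b = c) → 2 ≤ n → n ≤ m → (n = 2 → 3 ≤ m) →
    (n = 3 → 5 ≤ m) → m + n / 2 - 1 ≤ Fintype.card V → HasPath R n ∨ HasPath B m := by
  induction s using Nat.strong_induction_on with
  | _ s ih =>
    intro R B n m hs hmiss hn hnm h22 h33 hcard
    by_cases hmn : m = n
    · subst hmn
      have hmiss' : ∀ a b c, Missing B R a b → Missing B R a c → b = c := fun a b c h1 h2 =>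
        hmiss a b c ⟨h1.1, h1.2.2, h1.2.1⟩ ⟨h2.1, h2.2.2, h2.2.1⟩
      -- The colours may be exchanged, so a path on `m - 1` vertices in either colour is enough.
      have key : HasPath R (m - 1) ∨ HasPath B (m - 1) → HasPath R m ∨ HasPath B m := by
        rintro (hR | hB)
        · exact (hasPath_step hmiss' hn hnm h22 h33 hcard hR).symm
        · exact hasPath_step hmiss hn hnm h22 h33 hcard hB
      by_cases hm4 : m = 4
      · subst hm4
        exact key (hasPath_three_or_three hmiss (by omega))
      · rcases ih (m - 1 + m) (by omega) R B (m - 1) m rfl hmiss (by omega) (by omega) (by omega)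
          (by omega) (by omega) with hR | hB
        · exact key (Or.inl hR)
        · exact Or.inr hB
    · have hB : HasPath R n ∨ HasPath B (m - 1) := by
        by_cases h23 : n = 2 ∧ m = 3
        · obtain ⟨rfl, rfl⟩ := h23
          obtain ⟨u, v, w, huv, huw, hvw⟩ := Fintype.two_lt_card_iff.1
            (show 2 < Fintype.card V by omega)
          rcases adj_or_missing (R := R) (B := B) huv with h1 | h1 | h1
          · exact Or.inl (HasPath.two h1)
          · exact Or.inr (HasPath.two h1)
          rcases adj_or_missing (R := R) (B := B) huw with h2 | h2 | h2
          · exact Or.inl (HasPath.two h2)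
          · exact Or.inr (HasPath.two h2)
          exact absurd (hmiss _ _ _ h1 h2) hvw
        by_cases h35 : n = 3 ∧ m = 5
        · obtain ⟨rfl, rfl⟩ := h35
          exact hasPath_three_or_four hmiss (by omega)
        exact ih (n + (m - 1)) (by omega) R B n (m - 1) rfl hmiss hn (by omega) (by omega)
          (by omega) (by omega)
      rcases hB with hR | hB
      · exact Or.inl hR
      · exact hasPath_step hmiss hn hnm h22 h33 hcard hB

end Upper

/-! ### Colourings without the required paths, and the Ramsey numbers -/

section Colourings

variable {V : Type*} {n m N : ℕ}

lemma isContained_pathGraph_iff {G : SimpleGraph V} (hn : 0 < n) :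
    (pathGraph n).IsContained G ↔ HasPath G n := by
  constructor
  · rintro ⟨f⟩
    refine ⟨f ⟨0, hn⟩, f ⟨n - 1, by omega⟩, List.ofFn f, ⟨?_, ?_, ?_, ?_⟩, by simp⟩
    · rw [List.isChain_iff_getElem]
      intro i hi
      simp only [List.getElem_ofFn]
      exact f.toHom.map_adj (pathGraph_adj.2 (Or.inl rfl))
    · exact List.nodup_ofFn.2 f.injective
    · simp [List.head?_eq_getElem?, hn]
    · rw [List.getLast?_eq_getElem?]
      simp [hn]
  · rintro ⟨a, b, L, ⟨h1, h2, -, -⟩, hl⟩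
    have hadj : ∀ i (hi : i + 1 < n), G.Adj L[i] L[i + 1] := fun i hi =>
      List.isChain_iff_getElem.1 h1 i (by omega)
    refine ⟨⟨⟨fun i => L[i.1], ?_⟩, ?_⟩⟩
    · intro u v huv
      obtain ⟨u, hu⟩ := u
      obtain ⟨v, hv⟩ := v
      rcases pathGraph_adj.1 huv with h | h
      · dsimp only at h
        subst h
        exact hadj u hv
      · dsimp only at h
        subst h
        exact (hadj v hu).symm
    · intro u v huv
      exact Fin.ext ((h2.getElem_inj_iff).1 huv)

/-- The vertices less than `s` have all their edges in colour `r`, the other edges have colour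
`b`. -/
def splitLabeling {K : Type*} (N s : ℕ) (r b : K) : TopEdgeLabeling (Fin N) K :=
  EdgeLabeling.mk (fun u v _ => if u.1 < s ∨ v.1 < s then r else b)
    (fun u v _ => by simp only [or_comm])

lemma splitLabeling_get {K : Type*} {s : ℕ} {r b : K} {u v : Fin N} (h : u ≠ v) :
    (splitLabeling N s r b).get u v h = if u.1 < s ∨ v.1 < s then r else b := rfl

/-- A list without two consecutive elements outside a set is at most one longer than twice the
number of its elements in this set, and at most twice as long if it starts in the set. -/
lemma length_le_of_isChain {p : V → Prop} [DecidablePred p] :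
    ∀ L : List V, L.IsChain (fun u v => p u ∨ p v) →
      L.length ≤ 2 * L.countP p + 1 ∧ ((∀ a ∈ L.head?, p a) → L.length ≤ 2 * L.countP p)
  | [], _ => by simp
  | [v], _ => by
    by_cases hv : p v <;> simp [hv]
  | v :: w :: L, h => by
    rw [List.isChain_cons_cons] at h
    obtain ⟨h1, h2⟩ := length_le_of_isChain (w :: L) h.2
    by_cases hv : p v
    · have : (v :: w :: L).countP p = (w :: L).countP p + 1 := List.countP_cons_of_pos (by simpa)
      rw [List.length_cons, this]
      exact ⟨by omega, fun _ => by omega⟩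
    · have : (v :: w :: L).countP p = (w :: L).countP p := List.countP_cons_of_neg (by simpa)
      have := h2 (by simpa using h.1.resolve_left hv)
      rw [List.length_cons]
      exact ⟨by omega, fun h' => absurd (h' v (by simp)) hv⟩

lemma countP_lt_le {L : List (Fin N)} (hL : L.Nodup) (s : ℕ) :
    L.countP (fun u => u.1 < s) ≤ s := by
  rw [List.countP_eq_length_filter]
  have h1 : (L.filter (fun u => u.1 < s)).Nodup := hL.filter _
  have h2 : ((L.filter (fun u => u.1 < s)).map Fin.val).Nodup := h1.map Fin.val_injective
  have h3 : ((L.filter (fun u => u.1 < s)).map Fin.val).toFinset ⊆ Finset.range s := by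
    intro t ht
    simp only [List.mem_toFinset, List.mem_map, List.mem_filter, decide_eq_true_eq] at ht
    obtain ⟨u, ⟨-, hu⟩, rfl⟩ := ht
    simpa using hu
  have := Finset.card_le_card h3
  rw [List.toFinset_card_of_nodup h2, Finset.card_range, List.length_map] at this
  exact this

lemma not_hasPath_of_meets {G : SimpleGraph (Fin N)} {s : ℕ}
    (hG : ∀ u v, G.Adj u v → u.1 < s ∨ v.1 < s) (hn : 2 * s + 1 < n) : ¬ HasPath G n := by
  rintro ⟨a, b, L, hL, hl⟩
  have h1 := (length_le_of_isChain (p := fun u : Fin N => u.1 < s) L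
    (hL.1.imp fun u v huv => hG u v huv)).1
  have h2 := countP_lt_le hL.nodup s
  omega

lemma not_hasPath_of_avoids {G : SimpleGraph (Fin N)} {s : ℕ}
    (hG : ∀ u v, G.Adj u v → s ≤ u.1 ∧ s ≤ v.1) (hm : 2 ≤ m) (hN : N < m + s) :
    ¬ HasPath G m := by
  rintro ⟨a, b, L, hL, hl⟩
  have hs : ∀ u ∈ L, s ≤ u.1 := by
    intro u hu
    obtain ⟨i, hi, rfl⟩ := List.getElem_of_mem hu
    have hadj := List.isChain_iff_getElem.1 hL.1
    rcases Nat.lt_or_ge (i + 1) L.length with h | h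
    · exact (hG _ _ (hadj i h)).1
    · have := (hG _ _ (hadj (i - 1) (by omega))).2
      simpa only [Nat.sub_add_cancel (show 1 ≤ i by omega)] using this
  have h2 : (L.map Fin.val).Nodup := hL.nodup.map Fin.val_injective
  have h3 : (L.map Fin.val).toFinset ⊆ Finset.Ico s N := by
    intro t ht
    simp only [List.mem_toFinset, List.mem_map] at ht
    obtain ⟨u, hu, rfl⟩ := ht
    exact Finset.mem_Ico.2 ⟨hs u hu, u.2⟩
  have := Finset.card_le_card h3
  rw [List.toFinset_card_of_nodup h2, Nat.card_Ico, List.length_map] at this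
  omega

lemma le_of_arrows_two (hn : 2 ≤ n) (hm : 2 ≤ m) (h : Arrows (paths ![n, m]) N) :
    m + n / 2 - 1 ≤ N := by
  by_contra! hN
  obtain ⟨i, hi⟩ := h (splitLabeling N (n / 2 - 1) 0 1)
  fin_cases i
  · refine not_hasPath_of_meets (s := n / 2 - 1) ?_ (by omega)
      ((isContained_pathGraph_iff (n := n) (by omega)).1 hi)
    intro u v huv
    simp only [TopEdgeLabeling.labelGraph_adj, splitLabeling_get] at huv
    by_contra hcon
    simp [hcon] at huv
  · refine not_hasPath_of_avoids (s := n / 2 - 1) ?_ hm (by omega)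
      ((isContained_pathGraph_iff (n := m) (by omega)).1 hi)
    intro u v huv
    simp only [TopEdgeLabeling.labelGraph_adj, splitLabeling_get] at huv
    by_contra hcon
    rw [← not_lt, ← not_lt, ← not_or, not_not] at hcon
    simp [hcon] at huv

lemma le_of_arrows_three (hn : 2 ≤ n) (hm : 2 ≤ m) (h : Arrows (paths ![3, n, m]) N) :
    m + n / 2 - 1 ≤ N := by
  by_contra! hN
  obtain ⟨i, hi⟩ := h (splitLabeling N (n / 2 - 1) 1 2)
  fin_cases i
  · obtain ⟨a, b, c, hab, -, -⟩ :=
      ((isContained_pathGraph_iff (n := 3) (by omega)).1 hi).exists_three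
    simp only [TopEdgeLabeling.labelGraph_adj, splitLabeling_get] at hab
    obtain ⟨-, hab⟩ := hab
    split_ifs at hab <;> exact absurd hab (by decide)
  · refine not_hasPath_of_meets (s := n / 2 - 1) ?_ (by omega)
      ((isContained_pathGraph_iff (n := n) (by omega)).1 hi)
    intro u v huv
    simp only [TopEdgeLabeling.labelGraph_adj, splitLabeling_get] at huv
    by_contra hcon
    simp [hcon] at huv
  · refine not_hasPath_of_avoids (s := n / 2 - 1) ?_ hm (by omega)
      ((isContained_pathGraph_iff (n := m) (by omega)).1 hi)
    intro u v huv
    simp only [TopEdgeLabeling.labelGraph_adj, splitLabeling_get] at huv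
    by_contra hcon
    rw [← not_lt, ← not_lt, ← not_or, not_not] at hcon
    simp [hcon] at huv

/-- In the absence of `P₃` in colour `0`, the pairs of this colour form a matching. -/
lemma arrows_three_of_forall (hn : 0 < n) (hm : 0 < m)
    (H : ∀ R B : SimpleGraph (Fin N),
      (∀ a b c, Missing R B a b → Missing R B a c → b = c) → HasPath R n ∨ HasPath B m) :
    Arrows (paths ![3, n, m]) N := by
  intro c
  by_cases h3 : HasPath (c.labelGraph 0) 3
  · exact ⟨0, (isContained_pathGraph_iff (n := 3) (by omega)).2 h3⟩
  have key : ∀ a b, Missing (c.labelGraph 1) (c.labelGraph 2) a b → (c.labelGraph 0).Adj a b := by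
    rintro a b ⟨hab, h1, h2⟩
    rw [TopEdgeLabeling.labelGraph_adj] at h1 h2 ⊢
    refine ⟨hab, ?_⟩
    have e1 : c.get a b hab ≠ 1 := fun e => h1 ⟨hab, e⟩
    have e2 : c.get a b hab ≠ 2 := fun e => h2 ⟨hab, e⟩
    generalize c.get a b hab = t at e1 e2
    fin_cases t <;> simp_all
  rcases H (c.labelGraph 1) (c.labelGraph 2) (fun a b d h1 h2 => by
    by_contra hbd
    exact h3 (HasPath.three (key _ _ h1).symm (key _ _ h2) hbd)) with h | h
  · exact ⟨1, (isContained_pathGraph_iff (n := n) hn).2 h⟩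
  · exact ⟨2, (isContained_pathGraph_iff (n := m) hm).2 h⟩

lemma arrows_two_of_forall (hn : 0 < n) (hm : 0 < m)
    (H : ∀ R B : SimpleGraph (Fin N),
      (∀ a b c, Missing R B a b → Missing R B a c → b = c) → HasPath R n ∨ HasPath B m) :
    Arrows (paths ![n, m]) N := by
  intro c
  rcases H (c.labelGraph 0) (c.labelGraph 1) (fun a b d h1 h2 => by
    obtain ⟨hab, h1, h2⟩ := h1
    rw [TopEdgeLabeling.labelGraph_adj] at h1 h2
    have e1 : c.get a b hab ≠ 0 := fun e => h1 ⟨hab, e⟩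
    have e2 : c.get a b hab ≠ 1 := fun e => h2 ⟨hab, e⟩
    generalize c.get a b hab = t at e1 e2
    fin_cases t <;> simp_all) with h | h
  · exact ⟨0, (isContained_pathGraph_iff (n := n) hn).2 h⟩
  · exact ⟨1, (isContained_pathGraph_iff (n := m) hm).2 h⟩

/-- The colouring of the complete graph on four vertices by its three perfect matchings: the nonzero
elements of `(ℤ/2)²`, written in binary, index the colours. -/
def matchingLabeling (N : ℕ) : TopEdgeLabeling (Fin N) (Fin 3) :=
  EdgeLabeling.mk (fun u v _ => Fin.ofNat 3 (u.1 ^^^ v.1)) (fun u v _ => by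
    rw [Nat.xor_comm])

lemma not_hasPath_matchingLabeling (hN : N < 5) (i : Fin 3) :
    ¬ HasPath ((matchingLabeling N).labelGraph i) 3 := by
  intro h
  obtain ⟨a, b, c, hab, hbc, hac⟩ := h.exists_three
  rw [TopEdgeLabeling.labelGraph_adj] at hab hbc
  obtain ⟨nab, hab⟩ := hab
  obtain ⟨nbc, hbc⟩ := hbc
  have e : Fin.ofNat 3 (a.1 ^^^ b.1) = Fin.ofNat 3 (b.1 ^^^ c.1) := hab.trans hbc.symm
  have key : ∀ a b c : Fin 4, a ≠ b → b ≠ c →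
      Fin.ofNat 3 (a.1 ^^^ b.1) = Fin.ofNat 3 (b.1 ^^^ c.1) → a = c := by decide
  have := key ⟨a, by omega⟩ ⟨b, by omega⟩ ⟨c, by omega⟩ (by simpa [Fin.ext_iff] using nab)
    (by simpa [Fin.ext_iff] using nbc) e
  exact hac (by simpa [Fin.ext_iff] using this)

lemma HasPath.mono {G : SimpleGraph V} (h : HasPath G n) (hmn : m ≤ n) : HasPath G m := by
  obtain ⟨a, b, L, hL, hl⟩ := h
  exact ⟨a, b, L, hL, by omega⟩

lemma isRamseyNumber_five (hm : 3 ≤ m) (hm4 : m ≤ 4) : IsRamseyNumber (paths ![3, 3, m]) 5 := by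
  refine ⟨⟨by omega, arrows_three_of_forall (by omega) (by omega) fun R B hmiss => ?_⟩, ?_⟩
  · exact (hasPath_three_or_four hmiss (by simp)).imp_right fun h => h.mono hm4
  · rintro N ⟨-, hN⟩
    by_contra! hN5
    obtain ⟨i, hi⟩ := hN (matchingLabeling N)
    refine not_hasPath_matchingLabeling hN5 i (HasPath.mono (n := ![3, 3, m] i) ?_ ?_)
    · refine (isContained_pathGraph_iff ?_).1 hi
      fin_cases i <;> simp; omega
    · fin_cases i <;> simp [hm]

end Colourings

end RamseyPaths

theorem theorem1 :
    (∀ n m : ℕ, 2 ≤ n → n ≤ m → (n, m) ≠ (2, 2) → (n, m) ≠ (3, 3) → (n, m) ≠ (3, 4) →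
      RamseyPaths.IsRamseyNumber (RamseyPaths.paths ![3, n, m]) (m + n / 2 - 1) ∧
      RamseyPaths.IsRamseyNumber (RamseyPaths.paths ![n, m]) (m + n / 2 - 1)) ∧
    RamseyPaths.IsRamseyNumber (RamseyPaths.paths ![3, 3, 3]) 5 ∧
    RamseyPaths.IsRamseyNumber (RamseyPaths.paths ![3, 3, 4]) 5 := by
  refine ⟨fun n m hn hnm h22 h33 h34 => ?_, RamseyPaths.isRamseyNumber_five le_rfl (by omega),
    RamseyPaths.isRamseyNumber_five (by omega) le_rfl⟩
  simp only [ne_eq, Prod.mk.injEq] at h22 h33 h34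
  have H : ∀ R B : SimpleGraph (Fin (m + n / 2 - 1)),
      (∀ a b c, RamseyPaths.Missing R B a b → RamseyPaths.Missing R B a c → b = c) →
      RamseyPaths.HasPath R n ∨ RamseyPaths.HasPath B m := fun R B hmiss =>
    RamseyPaths.hasPath_or_hasPath (n + m) R B n m rfl hmiss hn hnm (by omega) (by omega) (by simp)
  exact ⟨⟨⟨by omega, RamseyPaths.arrows_three_of_forall (by omega) (by omega) H⟩,
      fun N hN => RamseyPaths.le_of_arrows_three hn (by omega) hN.2⟩,
    ⟨⟨by omega, RamseyPaths.arrows_two_of_forall (by omega) (by omega) H⟩,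
      fun N hN => RamseyPaths.le_of_arrows_two hn (by omega) hN.2⟩⟩
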